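/- Let $d$ be a positive odd integer, $\ell=\sqrt{2\pi/d}$, $\omega=e^{2\pi i/d}$, and write $[\mathbf a,\mathbf b]=a_Xb_Z-a_Zb_X$. *Qudit side.* For $\mathbf a\in\mathbb Z_d^2$ put $\bar T_{\mathbf a}=\omega^{2^{-1}a_Xa_Z}X^{a_X}Z^{a_Z}$, where $X|j\rangle=|j+1\rangle$, $Z|j\rangle=\omega^j|j\rangle$ and $2^{-1}=(d+1)/2$. The Gross Wigner function of a density matrix $\bar\rho$ on $\mathbb C^d$ is $\bar W_{\bar\rho}(\mathbf t)=\frac1d\sum_{\mathbf a\in\mathbb Z_d^2}\omega^{-[\mathbf t,\mathbf a]}\operatorname{Tr}(\bar T_{\mathbf a}\bar\rho)$, $\mathbf t\in\mathbb Z_d^2$. *Continuous-variable side.* On $L^2(\mathbb R)$ put $T_{\mathbf a}=e^{i\pi a_Xa_Z/d}e^{-i\ell a_X\hat p}e^{i\ell a_Z\hat q}$. The Zak-Gross Wigner function of a trace-class operator $\rho$ is the distribution $W_\rho(\boldsymbol\eta)=\operatorname{Tr}(\rho A_{\boldsymbol\eta})$ on $\mathbb R^2$ ($d\ell$-periodic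 in each coordinate), where $A_{\boldsymbol\eta}=\frac1{2\pi}\sum_{\mathbf a\in\mathbb Z^2}e^{i\ell[\mathbf a,\boldsymbol\eta]+i\pi a_Xa_Z}T_{\mathbf a}$. *Ideal states.* The ideal GKP state perfectly encoding $\bar\rho$ is the non-normalizable operator $\rho_L=\sum_{j,k}\bar\rho_{jk}|j_{\mathrm{GKP}}\rangle\langle k_{\mathrm{GKP}}|$ with $|j_{\mathrm{GKP}}\rangle=\ell^{-1/2}\sum_{n\in\mathbb Z}|(dn+j)\ell\rangle$, $j\in\{0,\dots,d-1\}$, a tempered distribution in the position representation. Its trace is infinite, so $W_{\rho_L}$ is understood up to normalization: for Schwartz functions $g,h$ on $\mathbb R$ with $g(0)=1$, $\int h=1$ and $\varepsilon,\delta>0$, let $E_{\varepsilon,\delta}u=\delta^{-1}h(\cdot/\delta)*\big(g(\varepsilon\,\cdot)\,u\big)$ (for Gaussian $g,h$ this produces the usual finitely squeezed GKP states), and let $W_{\rho_L}$ be the limit, in the sense of tempered distributions as $\varepsilon,\delta\to0^+$ jointly, of $W_{\rho_{\varepsilon,\delta}}$, where $\rho_{\varepsilon,\delta}=E_{\varepsilon,\delta}\rho_LE_{\varepsilon,\delta}^\dagger/\operatorname{Tr}(E_{\varepsilon,\delta}\rho_LE_{\varepsilon,\delta}^\dagger)$.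 **Claim.** For every density matrix $\bar\rho$ on $\mathbb C^d$ the limit exists, is the same for all $g,h$ (the traces being nonzero for all small $\varepsilon,\delta$), and $$W_{\rho_L}(\boldsymbol\eta)=\sum_{\mathbf a\in\mathbb Z^2}\delta(\boldsymbol\eta-\ell\mathbf a)\,\bar W_{\bar\rho}(\mathbf a \bmod d)$$ as tempered distributions on $\mathbb R^2$. Consequently, if $\bar W_{\bar\rho}\ge0$ everywhere, then $W_{\rho_L}$ is a nonnegative distribution. In particular $W_{\rho_L}$ is nonnegative whenever $\bar\rho=|\psi\rangle\langle\psi|$ is a stabilizer state, i.e. $\psi$ is a unit vector spanning the joint $+1$ eigenspace of a subgroup of the Pauli group $\{\omega^k\bar T_{\mathbf a}\}$. -/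

import Mathlib

open MeasureTheory Filter Topology SchwartzMap
open scoped ComplexOrder ComplexConjugate ENNReal Matrix

noncomputable section

namespace ZakGross

/-! ### Qudits: Weyl operators, the Gross Wigner function, stabilizer states -/

section Qudit

variable (d : ℕ) [NeZero d]

/-- The primitive character `k ↦ ω ^ k`, `ω = exp (2 π i / d)`. -/
def omega (k : ZMod d) : ℂ := ZMod.stdAddChar k

/-- The shift `X |j⟩ = |j + 1⟩`. -/
def pauliX : Matrix (ZMod d) (ZMod d) ℂ := Matrix.of fun k j => if k = j + 1 then 1 else 0

/-- The clock `Z |j⟩ = ω ^ j |j⟩`. -/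
def pauliZ : Matrix (ZMod d) (ZMod d) ℂ := Matrix.diagonal fun j => omega d j

/-- The inverse of `2` modulo an odd `d`, i.e. `(d + 1) / 2`. -/
def half : ZMod d := (((d + 1) / 2 : ℕ) : ZMod d)

/-- The qudit displacement `ω ^ (2⁻¹ a_X a_Z) X ^ a_X Z ^ a_Z`. -/
def weyl (a : ZMod d × ZMod d) : Matrix (ZMod d) (ZMod d) ℂ :=
  omega d (half d * a.1 * a.2) • (pauliX d ^ a.1.val * pauliZ d ^ a.2.val)

/-- The symplectic form `[a, b] = a_X b_Z - a_Z b_X`. -/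
def symp {R : Type*} [CommRing R] (a b : R × R) : R := a.1 * b.2 - a.2 * b.1

/-- The qudit phase point operator `d⁻¹ ∑ₐ ω ^ (-[t, a]) T_a`. -/
def grossPhasePoint (t : ZMod d × ZMod d) : Matrix (ZMod d) (ZMod d) ℂ :=
  (1 / (d : ℂ)) • ∑ a : ZMod d × ZMod d, omega d (-symp t a) • weyl d a

/-- The Gross Wigner function `Tr (A_t ρ)`. -/
def grossWigner (ρ : Matrix (ZMod d) (ZMod d) ℂ) (t : ZMod d × ZMod d) : ℂ :=
  (grossPhasePoint d t * ρ).trace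

/-- Density matrices. -/
def IsState (ρ : Matrix (ZMod d) (ZMod d) ℂ) : Prop := ρ.PosSemidef ∧ ρ.trace = 1

/-- Pure stabilizer states: `ρ = |ψ⟩⟨ψ|` where the unit vector `ψ` spans the joint `+1` eigenspace
of a subgroup `S` of the Pauli group `{ω ^ k T_a}`. -/
def IsStabilizerState (ρ : Matrix (ZMod d) (ZMod d) ℂ) : Prop :=
  ∃ ψ : ZMod d → ℂ, star ψ ⬝ᵥ ψ = 1 ∧ ρ = Matrix.vecMulVec ψ (star ψ) ∧
    ∃ S : Subgroup (Matrix (ZMod d) (ZMod d) ℂ)ˣ,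
      (∀ P ∈ S, ∃ (k : ZMod d) (a : ZMod d × ZMod d),
        (P : Matrix (ZMod d) (ZMod d) ℂ) = omega d k • weyl d a) ∧
      ∀ v : ZMod d → ℂ,
        (∀ P ∈ S, (P : Matrix (ZMod d) (ZMod d) ℂ) *ᵥ v = v) ↔ ∃ c : ℂ, v = c • ψ

end Qudit

/-! ### One bosonic mode: displacements, trace, the Zak-Gross Wigner function -/

/-- The Hilbert space `L²(ℝ)` of one mode, in the position representation. -/
abbrev Mode : Type := Lp ℂ 2 (volume : Measure ℝ)

/-- The phase space `ℝ²`; coordinate `0` is position-like (`X`), coordinate `1` momentum-like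
(`Z`). -/
abbrev Phase : Type := EuclideanSpace ℝ (Fin 2)

/-- The trace `∑ᵢ ⟨eᵢ, A eᵢ⟩` over an orthonormal basis (of whose choice it does not depend when `A`
is of trace class). -/
def trace (A : Mode →L[ℂ] Mode) : ℂ :=
  ∑' i, inner ℂ ((exists_hilbertBasis ℂ Mode).choose_spec.choose i)
    (A ((exists_hilbertBasis ℂ Mode).choose_spec.choose i))

/-- The lattice constant `ℓ = √(2 π / d)`. -/
def ell (d : ℕ) : ℝ := Real.sqrt (2 * Real.pi / d)

/-- The translation `exp (-i c p) : ψ ↦ ψ (· - c)`. -/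
def translation (c : ℝ) : Mode →L[ℂ] Mode :=
  (Lp.compMeasurePreservingₗᵢ ℂ (fun x : ℝ => x - c)
    (measurePreserving_sub_right volume c)).toContinuousLinearMap

theorem memLp_phase (c : ℝ) :
    MemLp (fun x : ℝ => Complex.exp (Complex.I * c * x)) ∞ (volume : Measure ℝ) := by
  refine memLp_top_of_bound (Continuous.aestronglyMeasurable (by fun_prop)) 1 (.of_forall ?_)
  intro x
  rw [Complex.norm_exp]
  simp

/-- The modulation `exp (i c q) : ψ ↦ exp (i c ·) ψ`. -/
def modulation (c : ℝ) : Mode →L[ℂ] Mode :=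
  (ContinuousLinearMap.mul ℂ ℂ).holderL (volume : Measure ℝ) ∞ 2 2 (memLp_phase c).toLp

/-- The displacement `T_a = exp (i π a_X a_Z / d) exp (-i ℓ a_X p) exp (i ℓ a_Z q)`. -/
def displacement (d : ℕ) (a : ℝ × ℝ) : Mode →L[ℂ] Mode :=
  Complex.exp (Complex.I * Real.pi * a.1 * a.2 / d) •
    (translation (ell d * a.1) ∘L modulation (ell d * a.2))

/-- The phase point operator
`A_η = (2 π)⁻¹ ∑_{a ∈ ℤ²} exp (i ℓ [a, η] + i π a_X a_Z) T_a`
is an operator-valued distribution in `η`; this is `∫ f(η) A_η dη`, for a test function `f`. The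
series converges absolutely in operator norm. -/
def phasePoint (d : ℕ) (f : 𝓢(Phase, ℂ)) : Mode →L[ℂ] Mode :=
  (1 / (2 * Real.pi) : ℂ) • ∑' a : ℤ × ℤ,
    (∫ η : Phase, f η * Complex.exp (Complex.I * ell d * symp ((a.1 : ℝ), (a.2 : ℝ)) (η 0, η 1)
      + Complex.I * Real.pi * a.1 * a.2)) • displacement d ((a.1 : ℝ), (a.2 : ℝ))

/-- The Zak-Gross Wigner function `W_ρ(η) = Tr (ρ A_η)` of a trace-class operator, as a
distribution: the value of `∫ f(η) W_ρ(η) dη`. -/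
def zakGross (d : ℕ) (ρ : Mode →L[ℂ] Mode) (f : 𝓢(Phase, ℂ)) : ℂ :=
  trace (ρ ∘L phasePoint d f)

/-! ### Non-normalizable states and ideal GKP encoding -/

/-- Generalized operators: continuous linear maps from test functions to tempered distributions. -/
abbrev GenOp : Type := 𝓢(ℝ, ℂ) →L[ℂ] 𝓢'(ℝ, ℂ)

/-- Complex conjugation of test functions. -/
def schwartzConj : 𝓢(ℝ, ℂ) →L[ℝ] 𝓢(ℝ, ℂ) :=
  postcompCLM (𝕜 := ℝ) (Complex.conjCLE : ℂ →L[ℝ] ℂ)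

@[simp] theorem schwartzConj_apply (φ : 𝓢(ℝ, ℂ)) (x : ℝ) : schwartzConj φ x = conj (φ x) := rfl

theorem schwartzConj_smul (c : ℂ) (φ : 𝓢(ℝ, ℂ)) :
    schwartzConj (c • φ) = conj c • schwartzConj φ := by
  ext x; simp

/-- The operator `|u⟩⟨v|`. A tempered distribution `v` is paired bilinearly with test functions, so
`⟨v|φ⟩` is the conjugate of `v` evaluated at the conjugate of `φ`. -/
def ketBra (u v : 𝓢'(ℝ, ℂ)) : GenOp where
  toFun φ := conj (v (schwartzConj φ)) • u
  map_add' φ χ := by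
    ext χ'
    change conj (v (schwartzConj (φ + χ))) * u χ' =
      conj (v (schwartzConj φ)) * u χ' + conj (v (schwartzConj χ)) * u χ'
    rw [map_add, map_add, map_add, add_mul]
  map_smul' c φ := by simp [schwartzConj_smul, mul_smul]
  cont := by
    have h : Continuous fun φ : 𝓢(ℝ, ℂ) => conj (v (schwartzConj φ)) :=
      Complex.continuous_conj.comp (v.continuous.comp schwartzConj.continuous)
    refine PointwiseConvergenceCLM.continuous_of_continuous_eval fun χ => ?_
    exact h.mul continuous_const

/-- The points `(d n + j) ℓ` of the ideal codeword `j`. -/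
def gkpPoint (d : ℕ) (j : ZMod d) (n : ℤ) : ℝ := (d * n + j.val) * ell d

theorem ell_pos (d : ℕ) [NeZero d] : 0 < ell d := by
  have : (0 : ℝ) < d := by exact_mod_cast Nat.pos_of_neZero d
  unfold ell; positivity

theorem summable_gkpWeight (d : ℕ) [NeZero d] (j : ZMod d) :
    Summable fun n : ℤ => ((1 + ‖gkpPoint d j n‖) ^ 2)⁻¹ := by
  have hd : (0 : ℝ) < d := by exact_mod_cast Nat.pos_of_neZero d
  have hl := ell_pos d
  have h1 : Summable fun n : ℤ => 1 / |(n : ℝ) + j.val / d| ^ (2 : ℝ) :=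
    (Real.summable_one_div_int_add_rpow _ 2).2 (by norm_num)
  refine Summable.of_norm_bounded_eventually (h1.mul_left ((d * ell d) ^ 2)⁻¹) ?_
  have hfin : {n : ℤ | (n : ℝ) + j.val / d = 0}.Finite := by
    refine Set.Subsingleton.finite fun a ha b hb => ?_
    have h : (a : ℝ) = b := by
      simp only [Set.mem_ofPred_eq] at ha hb
      linarith
    exact_mod_cast h
  filter_upwards [hfin.compl_mem_cofinite] with n hn
  have hn' : (n : ℝ) + j.val / d ≠ 0 := hn
  have hpos : 0 < |(n : ℝ) + j.val / d| := abs_pos.2 hn'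
  have e : ‖gkpPoint d j n‖ = d * ell d * |(n : ℝ) + j.val / d| := by
    have : gkpPoint d j n = d * ell d * ((n : ℝ) + j.val / d) := by
      unfold gkpPoint; field_simp
    rw [this, Real.norm_eq_abs, abs_mul, abs_of_pos (by positivity)]
  rw [e, Real.norm_of_nonneg (by positivity), Real.rpow_two, one_div, ← mul_inv, ← mul_pow]
  gcongr
  linarith

theorem gkp_bound (φ : 𝓢(ℝ, ℂ)) (x : ℝ) :
    ‖φ x‖ ≤ ((1 + ‖x‖) ^ 2)⁻¹ *
      (2 ^ 2 * (Finset.Iic (2, 0)).sup (schwartzSeminormFamily ℂ ℝ ℂ) φ) := by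
  have h := one_add_le_sup_seminorm_apply (𝕜 := ℂ) (m := (2, 0)) le_rfl le_rfl φ x
  rw [norm_iteratedFDeriv_zero] at h
  rw [inv_mul_eq_div, le_div_iff₀ (by positivity), mul_comm]
  exact h

theorem summable_gkp (d : ℕ) [NeZero d] (j : ZMod d) (φ : 𝓢(ℝ, ℂ)) :
    Summable fun n : ℤ => φ (gkpPoint d j n) :=
  Summable.of_norm_bounded ((summable_gkpWeight d j).mul_right _) fun _ => gkp_bound φ _

/-- The ideal codeword `|j_GKP⟩ = ℓ^(-1/2) ∑ₙ |(d n + j) ℓ⟩`, where the position ket `|x⟩` is the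
Dirac distribution at `x`. -/
def gkpKet (d : ℕ) [NeZero d] (j : ZMod d) : 𝓢'(ℝ, ℂ) :=
  ContinuousLinearMap.toPointwiseConvergenceCLM _ _ _ _ <|
    mkCLMtoNormedSpace (σ := RingHom.id ℂ)
      (fun φ : 𝓢(ℝ, ℂ) => (1 / Real.sqrt (ell d) : ℂ) * ∑' n : ℤ, φ (gkpPoint d j n))
      (fun φ χ => by
        simp only [add_apply]
        rw [(summable_gkp d j φ).tsum_add (summable_gkp d j χ), mul_add])
      (fun c φ => by
        simp only [smul_apply, smul_eq_mul, RingHom.id_apply]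
        rw [tsum_mul_left]; ring)
      ⟨Finset.Iic (2, 0), ‖(1 / Real.sqrt (ell d) : ℂ)‖ *
          ((∑' n : ℤ, ((1 + ‖gkpPoint d j n‖) ^ 2)⁻¹) * 2 ^ 2), by positivity, fun φ => by
        rw [norm_mul, mul_assoc, mul_assoc]
        gcongr
        rw [← tsum_mul_right]
        exact tsum_of_norm_bounded ((summable_gkpWeight d j).mul_right _).hasSum
          fun _ => gkp_bound φ _⟩

/-- The ideal GKP state `∑_{j,k} ρ_{jk} |j_GKP⟩⟨k_GKP|` that perfectly encodes `ρ`. -/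
def gkpEncode (d : ℕ) [NeZero d] (ρ : Matrix (ZMod d) (ZMod d) ℂ) : GenOp :=
  ∑ j, ∑ k, ρ j k • ketBra (gkpKet d j) (gkpKet d k)

/-! ### The Zak-Gross Wigner function of a non-normalizable state

For functions `g`, `h` with `g 0 = 1`, `∫ h = 1`, the operator
`E u = h_δ * (g (ε ·) u)`, `h_δ = δ⁻¹ h (· / δ)`, tends to the identity as `ε, δ → 0`. It cuts off
large positions and momenta, so that `E ρ E†` is of trace class for every generalized operator `ρ`.
(For Gaussian `g`, `h`, the `E |j_GKP⟩` are the usual finitely squeezed codewords.) The Wigner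
function of `ρ` is the limit of those of the normalized operators `E ρ E† / Tr (E ρ E†)`. -/

/-- Multiplication by `c ≠ 0` of the argument of a test function. -/
def dilate (f : 𝓢(ℝ, ℂ)) {c : ℝ} (hc : c ≠ 0) : 𝓢(ℝ, ℂ) :=
  compCLMOfContinuousLinearEquiv ℂ (ContinuousLinearEquiv.smulLeft (Units.mk0 c hc) : ℝ ≃L[ℝ] ℝ) f

/-- The integral kernel `y ↦ δ⁻¹ h ((x - y) / δ) g (ε y)` of `E`, at a fixed `x`. -/
def regRow (g h : 𝓢(ℝ, ℂ)) {ε δ : ℝ} (hε : 0 < ε) (hδ : 0 < δ) (x : ℝ) : 𝓢(ℝ, ℂ) :=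
  (δ⁻¹ : ℂ) • pairing (ContinuousLinearMap.mul ℂ ℂ)
    (compSubConstCLM ℂ x (dilate h (neg_ne_zero.2 (inv_ne_zero hδ.ne')))) (dilate g hε.ne')

theorem regRow_apply (g h : 𝓢(ℝ, ℂ)) {ε δ : ℝ} (hε : 0 < ε) (hδ : 0 < δ) (x y : ℝ) :
    regRow g h hε hδ x y = (δ : ℂ)⁻¹ * (h ((x - y) / δ) * g (ε * y)) := by
  have e : -δ⁻¹ * (y - x) = (x - y) / δ := by field_simp; ring
  simp [regRow, dilate, Units.smul_def, ← e]

/-- The kernel `⟨x| E ρ E† |x'⟩` of the regularized operator. -/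
def regKernel (g h : 𝓢(ℝ, ℂ)) {ε δ : ℝ} (hε : 0 < ε) (hδ : 0 < δ) (ρ : GenOp) (x x' : ℝ) : ℂ :=
  ρ (schwartzConj (regRow g h hε hδ x')) (regRow g h hε hδ x)

/-- `A` is the integral operator on `L²(ℝ)` with kernel `k`. -/
def IsIntegralOperator (k : ℝ → ℝ → ℂ) (A : Mode →L[ℂ] Mode) : Prop :=
  ∀ ψ : Mode, (A ψ : ℝ → ℂ) =ᵐ[volume] fun x => ∫ y, k x y * ψ y

/-- `W` is the (trace-normalized) Zak-Gross Wigner function of the generalized operator `ρ`: it is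
the limit of the Zak-Gross Wigner functions of `E ρ E† / Tr (E ρ E†)`, for every regularization. -/
def HasZakGross (d : ℕ) (ρ : GenOp) (W : 𝓢'(Phase, ℂ)) : Prop :=
  ∀ g h : 𝓢(ℝ, ℂ), g 0 = 1 → ∫ x, h x = 1 →
    ∃ A : ℝ → ℝ → (Mode →L[ℂ] Mode),
      (∀ (ε δ : ℝ) (hε : 0 < ε) (hδ : 0 < δ),
        IsIntegralOperator (regKernel g h hε hδ ρ) (A ε δ)) ∧
      (∀ᶠ p : ℝ × ℝ in 𝓝[>] 0 ×ˢ 𝓝[>] 0, trace (A p.1 p.2) ≠ 0) ∧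
      ∀ f : 𝓢(Phase, ℂ),
        Tendsto (fun p : ℝ × ℝ => zakGross d ((trace (A p.1 p.2))⁻¹ • A p.1 p.2) f)
          (𝓝[>] 0 ×ˢ 𝓝[>] 0) (𝓝 (W f))

/-- The point `ℓ a` of the lattice `ℓ ℤ²`. -/
def latticePoint (d : ℕ) (a : ℤ × ℤ) : Phase := !₂[ell d * a.1, ell d * a.2]

/-- A distribution that is nonnegative: it is nonnegative on nonnegative test functions. -/
def IsNonneg (W : 𝓢'(Phase, ℂ)) : Prop :=
  ∀ f : 𝓢(Phase, ℂ), (∀ η, 0 ≤ f η) → 0 ≤ W f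

end ZakGross

end

/-!
The matrix elements `⟨E k_GKP| T_a |E j_GKP⟩`, `a ∈ ℤ²`, are sums over pairs of peaks. Multiplied by
`ε δ` they are bounded uniformly in `ε` and `δ`, and only the pairs of peaks that `T_a` superposes
survive in the limit, where Riemann sums become integrals. The limit is the matrix element
`⟨k| T_{a mod d} |j⟩` of the qudit displacement times `(-1) ^ (a_X a_Z)` and a constant that depends
on neither `j`, `k` nor `a`; the normalization by the trace removes the constant. The same sign in
the definition of `A_η` cancels this one, so that the Wigner function of the encoded state is the
sum of the plane waves `exp (i ℓ [a, η])` with the `d`-periodic coefficients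
`Tr (T_{a mod d} ρ) / 2 π`. By finite Fourier inversion and Poisson summation this is the comb of
the Gross Wigner function.
-/

namespace ZakGross

/-! ### The symplectic form and the Weyl operators -/

section Symp

variable {R : Type*} [CommRing R] (a b c : R × R)

theorem symp_self : symp a a = 0 := by
  simp only [symp]; ring

theorem symp_swap : symp b a = -symp a b := by
  simp only [symp]; ring

theorem symp_add_right : symp a (b + c) = symp a b + symp a c := by
  simp only [symp, Prod.fst_add, Prod.snd_add]; ring

theorem symp_neg_right : symp a (-b) = -symp a b := by
  simp only [symp, Prod.fst_neg, Prod.snd_neg]; ring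

theorem symp_neg_left : symp (-a) b = -symp a b := by
  rw [symp_swap, symp_neg_right, symp_swap, neg_neg]

end Symp

section Weyl

theorem two_mul_half {d : ℕ} (hd : Odd d) : 2 * half d = 1 := by
  have h : 2 * ((d + 1) / 2) = d + 1 := Nat.two_mul_div_two_of_even hd.add_one
  have h' : ((2 * ((d + 1) / 2) : ℕ) : ZMod d) = (d + 1 : ℕ) := congrArg _ h
  simpa [half] using h'

variable {d : ℕ} [NeZero d]

theorem omega_add (k l : ZMod d) : omega d (k + l) = omega d k * omega d l :=
  AddChar.map_add_eq_mul _ _ _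

@[simp] theorem omega_zero : omega d 0 = 1 := AddChar.map_zero_eq_one _

theorem omega_pow (k : ZMod d) (n : ℕ) : omega d k ^ n = omega d (n * k) := by
  rw [← nsmul_eq_mul]
  exact (AddChar.map_nsmul_eq_pow _ _ _).symm

theorem omega_intCast (k : ℤ) :
    omega d (k : ZMod d) = Complex.exp (2 * Real.pi * Complex.I * k / d) :=
  ZMod.stdAddChar_coe k

theorem omega_eq_one_iff {k : ZMod d} : omega d k = 1 ↔ k = 0 := by
  rw [← omega_zero (d := d)]
  exact ZMod.injective_stdAddChar.eq_iff

theorem conj_omega (k : ZMod d) : conj (omega d k) = omega d (-k) :=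
  (AddChar.map_neg_eq_conj _ _).symm

theorem sum_omega_mul (a : ZMod d) :
    ∑ j : ZMod d, omega d (j * a) = if a = 0 then (d : ℂ) else 0 := by
  simpa [ZMod.card, omega] using AddChar.sum_mulShift a (ZMod.isPrimitive_stdAddChar d)

theorem sum_omega_symp (a : ZMod d × ZMod d) :
    ∑ t : ZMod d × ZMod d, omega d (symp t a) = if a = 0 then (d : ℂ) ^ 2 else 0 := by
  have h (t : ZMod d × ZMod d) :
      omega d (symp t a) = omega d (t.1 * a.2) * omega d (t.2 * -a.1) := by
    rw [← omega_add, symp, mul_neg, sub_eq_add_neg]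
  simp_rw [h, Fintype.sum_prod_type, ← Finset.mul_sum, ← Finset.sum_mul, sum_omega_mul,
    neg_eq_zero, Prod.ext_iff, Prod.fst_zero, Prod.snd_zero]
  split_ifs <;> simp_all [sq]

theorem pauliX_pow_apply (n : ℕ) (k j : ZMod d) :
    (pauliX d ^ n) k j = if k = j + n then 1 else 0 := by
  induction n generalizing k j with
  | zero => simp [Matrix.one_apply]
  | succ n ih =>
    have h (i : ZMod d) : pauliX d i j = if i = j + 1 then 1 else 0 := rfl
    rw [pow_succ, Matrix.mul_apply]
    simp only [ih, h, mul_ite, mul_one, mul_zero, Finset.sum_ite_eq', Finset.mem_univ, if_true]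
    push_cast
    rw [add_assoc, add_comm (1 : ZMod d)]

theorem weyl_apply (a : ZMod d × ZMod d) (k j : ZMod d) :
    weyl d a k j = if k = j + a.1 then omega d (half d * a.1 * a.2 + a.2 * j) else 0 := by
  rw [weyl, Matrix.smul_apply, pauliZ, Matrix.diagonal_pow, Matrix.mul_diagonal, pauliX_pow_apply,
    ZMod.natCast_zmod_val, Pi.pow_apply, omega_pow, ZMod.natCast_zmod_val, omega_add, smul_eq_mul]
  split_ifs <;> simp

@[simp] theorem weyl_zero : weyl d 0 = 1 := by
  ext k j
  simp [weyl_apply, Matrix.one_apply]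

theorem weyl_mul (hd : Odd d) (a b : ZMod d × ZMod d) :
    weyl d a * weyl d b = omega d (-(half d * symp a b)) • weyl d (a + b) := by
  ext k j
  have e : k = j + b.1 + a.1 ↔ k = j + (a + b).1 := by
    rw [Prod.fst_add, add_assoc, add_comm b.1]
  rw [Matrix.mul_apply, Matrix.smul_apply, weyl_apply]
  simp only [weyl_apply, mul_ite, mul_zero, Finset.sum_ite_eq', Finset.mem_univ, if_true,
    smul_eq_mul, ite_mul, zero_mul, e]
  split_ifs
  · rw [← omega_add, ← omega_add]
    congr 1
    simp only [symp, Prod.fst_add, Prod.snd_add]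
    linear_combination (-a.2 * b.1) * two_mul_half hd
  · rfl

theorem conjTranspose_weyl (hd : Odd d) (a : ZMod d × ZMod d) : (weyl d a)ᴴ = weyl d (-a) := by
  ext k j
  have e : j = k + a.1 ↔ k = j + (-a).1 := by
    rw [Prod.fst_neg, ← sub_eq_add_neg, eq_sub_iff_add_eq, eq_comm]
  rw [Matrix.conjTranspose_apply, weyl_apply, weyl_apply, apply_ite star, star_zero]
  refine if_ctx_congr e (fun h => ?_) fun _ => rfl
  rw [← starRingEnd_apply, conj_omega, h, Prod.fst_neg, Prod.snd_neg]
  congr 1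
  linear_combination (-a.1 * a.2) * two_mul_half hd

theorem trace_weyl (a : ZMod d × ZMod d) :
    (weyl d a).trace = if a = 0 then (d : ℂ) else 0 := by
  simp only [Matrix.trace, Matrix.diag_apply, weyl_apply, left_eq_add]
  by_cases h : a.1 = 0
  · simp only [h, if_true, mul_zero, zero_mul, zero_add, mul_comm a.2, sum_omega_mul,
      Prod.ext_iff, Prod.fst_zero, Prod.snd_zero, true_and]
  · simp [h, Prod.ext_iff]

theorem grossWigner_eq_sum (ρ : Matrix (ZMod d) (ZMod d) ℂ) (t : ZMod d × ZMod d) :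
    grossWigner d ρ t = (1 / (d : ℂ)) *
      ∑ a : ZMod d × ZMod d, omega d (-symp t a) * (weyl d a * ρ).trace := by
  simp [grossWigner, grossPhasePoint, Finset.sum_mul, Matrix.trace_sum]

theorem trace_weyl_mul_eq_sum_grossWigner (ρ : Matrix (ZMod d) (ZMod d) ℂ)
    (a : ZMod d × ZMod d) :
    (weyl d a * ρ).trace =
      (1 / (d : ℂ)) * ∑ t : ZMod d × ZMod d, omega d (symp t a) * grossWigner d ρ t := by
  have hd : (d : ℂ) ≠ 0 := NeZero.ne _
  have h (t b : ZMod d × ZMod d) :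
      omega d (symp t a) * omega d (-symp t b) = omega d (symp t (a - b)) := by
    rw [← omega_add, sub_eq_add_neg, symp_add_right, symp_neg_right]
  simp_rw [grossWigner_eq_sum, mul_left_comm _ (1 / (d : ℂ)), ← Finset.mul_sum, Finset.mul_sum,
    ← mul_assoc]
  rw [Finset.sum_comm]
  simp_rw [mul_assoc, ← mul_assoc (omega d _), h, ← Finset.mul_sum, ← Finset.sum_mul,
    sum_omega_symp, sub_eq_zero, ite_mul, zero_mul]
  rw [Finset.sum_ite_eq, if_pos (Finset.mem_univ _)]
  field_simp

theorem trace_grossPhasePoint_mul_weyl (hd : Odd d) (t b : ZMod d × ZMod d) :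
    (grossPhasePoint d t * weyl d b).trace = omega d (symp t b) := by
  have hd0 : (d : ℂ) ≠ 0 := NeZero.ne _
  change grossWigner d (weyl d b) t = _
  simp_rw [grossWigner_eq_sum, weyl_mul hd, Matrix.trace_smul, trace_weyl,
    add_eq_zero_iff_eq_neg, smul_eq_mul, mul_ite, mul_zero]
  rw [Finset.sum_ite_eq' _ (-b), if_pos (Finset.mem_univ _), symp_neg_left, symp_self,
    symp_neg_right, neg_neg, neg_zero, mul_zero, neg_zero, omega_zero]
  field_simp

end Weyl

/-! ### Stabilizer states -/

section Stabilizer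

theorem vecMul_star_of_mulVec_eq {n R : Type*} [Fintype n] [DecidableEq n] [CommRing R] [StarRing R]
    {U : Matrix n n R} (hU : Uᴴ * U = 1) {v : n → R} (h : U *ᵥ v = v) :
    star v ᵥ* U = star v := by
  have h' : Uᴴ *ᵥ v = v := by
    conv_lhs => rw [← h]
    rw [Matrix.mulVec_mulVec, hU, Matrix.one_mulVec]
  simpa only [Matrix.star_mulVec, Matrix.conjTranspose_conjTranspose] using congrArg star h'

/- Both sides are `|S|` times a projection onto the joint fixed line of `S`. -/
theorem sum_coe_eq_card_smul_vecMulVec {n R : Type*} [Fintype n] [DecidableEq n] [CommRing R]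
    {φ ψ : n → R} (hφψ : φ ⬝ᵥ ψ = 1) (S : Subgroup (Matrix n n R)ˣ) [Fintype S]
    (hφ : ∀ P ∈ S, φ ᵥ* (P : Matrix n n R) = φ)
    (hψ : ∀ v : n → R, (∀ P ∈ S, (P : Matrix n n R) *ᵥ v = v) → ∃ c : R, v = c • ψ) :
    ∑ P : S, ((P : (Matrix n n R)ˣ) : Matrix n n R) =
      (Fintype.card S : R) • Matrix.vecMulVec ψ φ := by
  set Q := ∑ P : S, ((P : (Matrix n n R)ˣ) : Matrix n n R) with hQ
  have hφQ : φ ᵥ* Q = (Fintype.card S : R) • φ := by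
    rw [hQ, Matrix.vecMul_sum, Finset.sum_congr rfl fun (P : S) _ => hφ P P.2, Finset.sum_const,
      Finset.card_univ, Nat.cast_smul_eq_nsmul]
  have hSQ : ∀ P ∈ S, (P : Matrix n n R) * Q = Q := fun P hP => by
    rw [hQ, Finset.mul_sum]
    exact Fintype.sum_equiv (Equiv.mulLeft (⟨P, hP⟩ : S)) _ _ fun _ => rfl
  refine Matrix.ext_of_mulVec_single fun i => ?_
  set v : n → R := Pi.single i 1
  obtain ⟨c, hc⟩ := hψ (Q *ᵥ v) fun P hP => by rw [Matrix.mulVec_mulVec, hSQ P hP]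
  have hc' : (Fintype.card S : R) * (φ ⬝ᵥ v) = c := by
    have := congrArg (φ ⬝ᵥ ·) hc
    simpa only [Matrix.dotProduct_mulVec, hφQ, smul_dotProduct, dotProduct_smul, hφψ, smul_eq_mul,
      mul_one] using this
  rw [hc, Matrix.smul_mulVec, Matrix.vecMulVec_mulVec, op_smul_eq_smul, smul_smul, hc']

variable {d : ℕ} [NeZero d]

/-- The elements `ω ^ k T_a` of the qudit Pauli group. -/
def IsPauli (P : Matrix (ZMod d) (ZMod d) ℂ) : Prop :=
  ∃ (k : ZMod d) (a : ZMod d × ZMod d), P = omega d k • weyl d a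

theorem finite_setOf_isPauli : {P : Matrix (ZMod d) (ZMod d) ℂ | IsPauli P}.Finite := by
  refine (Set.finite_range fun x : ZMod d × ZMod d × ZMod d => omega d x.1 • weyl d x.2).subset ?_
  rintro P ⟨k, a, rfl⟩
  exact ⟨(k, a), rfl⟩

theorem IsPauli.conjTranspose_mul_self (hd : Odd d) {P : Matrix (ZMod d) (ZMod d) ℂ}
    (hP : IsPauli P) : Pᴴ * P = 1 := by
  obtain ⟨k, a, rfl⟩ := hP
  rw [Matrix.conjTranspose_smul, conjTranspose_weyl hd, ← starRingEnd_apply, conj_omega,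
    Matrix.smul_mul, Matrix.mul_smul, weyl_mul hd, smul_smul, smul_smul, ← omega_add, ← omega_add,
    symp_neg_left, symp_self]
  simp

theorem symp_eq_zero_of_mulVec_eq (hd : Odd d) {ψ : ZMod d → ℂ} (hψ : ψ ≠ 0) {k l : ZMod d}
    {a b : ZMod d × ZMod d} (ha : (omega d k • weyl d a) *ᵥ ψ = ψ)
    (hb : (omega d l • weyl d b) *ᵥ ψ = ψ) : symp a b = 0 := by
  set P := omega d k • weyl d a with hP
  set R := omega d l • weyl d b with hR
  have hcomm : R * P = omega d (symp a b) • (P * R) := by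
    simp only [hP, hR, Matrix.smul_mul, Matrix.mul_smul, weyl_mul hd, smul_smul, ← omega_add,
      symp_swap a b, add_comm b a]
    congr 2
    linear_combination symp a b * two_mul_half hd
  have hψ' : omega d (symp a b) • ψ = ψ := by
    have := congrArg (· *ᵥ ψ) hcomm
    simpa only [Matrix.smul_mulVec, ← Matrix.mulVec_mulVec, ha, hb] using this.symm
  refine omega_eq_one_iff.1 (smul_left_injective ℂ hψ ?_)
  simpa only [one_smul] using hψ'

theorem trace_grossPhasePoint_mul_mul (hd : Odd d) (t : ZMod d × ZMod d) {ψ : ZMod d → ℂ}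
    (hψ : ψ ≠ 0) {P R : Matrix (ZMod d) (ZMod d) ℂ} (hP : IsPauli P) (hR : IsPauli R)
    (hPψ : P *ᵥ ψ = ψ) (hRψ : R *ᵥ ψ = ψ) :
    (grossPhasePoint d t * (P * R)).trace =
      (grossPhasePoint d t * P).trace * (grossPhasePoint d t * R).trace := by
  obtain ⟨k, a, rfl⟩ := hP
  obtain ⟨l, b, rfl⟩ := hR
  have hab : symp a b = 0 := symp_eq_zero_of_mulVec_eq hd hψ hPψ hRψ
  simp only [Matrix.smul_mul, Matrix.mul_smul, weyl_mul hd, hab, Matrix.trace_smul,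
    trace_grossPhasePoint_mul_weyl hd, smul_eq_mul, symp_add_right, omega_add, mul_zero, neg_zero,
    omega_zero, one_smul]
  ring

theorem trace_grossPhasePoint (hd : Odd d) (t : ZMod d × ZMod d) :
    (grossPhasePoint d t).trace = 1 := by
  simpa [symp] using trace_grossPhasePoint_mul_weyl hd t 0

/- On the stabilizer group `P ↦ Tr (A_t P)` is a character, and the sum of a character over a finite
group is either `0` or the order of the group. -/
theorem grossWigner_nonneg_of_isStabilizerState (hd : Odd d) {ρ : Matrix (ZMod d) (ZMod d) ℂ}
    (hρ : IsStabilizerState d ρ) (t : ZMod d × ZMod d) : 0 ≤ grossWigner d ρ t := by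
  classical
  obtain ⟨ψ, hψ, rfl, S, hS, hfix⟩ := hρ
  have hψ0 : ψ ≠ 0 := by rintro rfl; simp at hψ
  have hSψ : ∀ P ∈ S, (P : Matrix (ZMod d) (ZMod d) ℂ) *ᵥ ψ = ψ :=
    (hfix ψ).2 ⟨1, (one_smul _ _).symm⟩
  have : Finite S := (finite_setOf_isPauli.preimage Units.val_injective.injOn).subset hS
  let _ : Fintype S := Fintype.ofFinite S
  let χ : S →* ℂ :=
    { toFun P := (grossPhasePoint d t * ((P : (Matrix (ZMod d) (ZMod d) ℂ)ˣ) :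
        Matrix (ZMod d) (ZMod d) ℂ)).trace
      map_one' := by simp [trace_grossPhasePoint hd]
      map_mul' P R := trace_grossPhasePoint_mul_mul hd t hψ0 (hS P P.2) (hS R R.2) (hSψ P P.2)
        (hSψ R R.2) }
  have hsum : (Fintype.card S : ℂ) * grossWigner d (Matrix.vecMulVec ψ (star ψ)) t = ∑ P, χ P := by
    rw [grossWigner, ← smul_eq_mul, ← Matrix.trace_smul, ← Matrix.mul_smul,
      ← sum_coe_eq_card_smul_vecMulVec hψ S (fun P hP => vecMul_star_of_mulVec_eq
        (IsPauli.conjTranspose_mul_self hd (hS P hP)) (hSψ P hP)) fun v => (hfix v).1,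
      Finset.mul_sum, Matrix.trace_sum]
    rfl
  have hcard : (0 : ℂ) < Fintype.card S := by exact_mod_cast Fintype.card_pos
  refine le_of_mul_le_mul_left ?_ hcard
  rw [mul_zero, hsum, sum_hom_units]
  split_ifs
  · exact Nat.cast_nonneg _
  · exact le_of_eq (Nat.cast_zero).symm

end Stabilizer

/-! ### Decay of Schwartz functions -/

section Decay

theorem norm_apply_le_sup_seminorm_mul (𝕜 : Type*) {E F : Type*} [NormedAddCommGroup E]
    [NormedSpace ℝ E] [NormedAddCommGroup F] [NormedSpace ℝ F] [NormedField 𝕜] [NormedSpace 𝕜 F]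
    [SMulCommClass ℝ 𝕜 F] (φ : 𝓢(E, F)) (n : ℕ) (x : E) :
    ‖φ x‖ ≤ 2 ^ (2 * n) * (Finset.Iic (2 * n, 0)).sup (schwartzSeminormFamily 𝕜 E F) φ *
      ((1 + ‖x‖ ^ 2)⁻¹) ^ n := by
  have h := one_add_le_sup_seminorm_apply (𝕜 := 𝕜) (m := (2 * n, 0)) le_rfl le_rfl φ x
  rw [norm_iteratedFDeriv_zero] at h
  rw [inv_pow, ← div_eq_mul_inv, le_div_iff₀ (by positivity), mul_comm]
  refine le_trans ?_ h
  rw [pow_mul]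
  gcongr
  nlinarith [norm_nonneg x]

theorem exists_norm_apply_le_mul_inv_one_add_sq (φ : 𝓢(ℝ, ℂ)) :
    ∃ C : ℝ, ∀ x, ‖φ x‖ ≤ C * (1 + x ^ 2)⁻¹ :=
  ⟨_, fun x => by simpa using norm_apply_le_sup_seminorm_mul ℂ φ 1 x⟩

theorem inv_one_add_norm_sq_le (x y : ℝ) :
    ((1 + ‖(!₂[x, y] : Phase)‖ ^ 2)⁻¹) ^ 2 ≤ (1 + x ^ 2)⁻¹ * (1 + y ^ 2)⁻¹ := by
  have e : ‖(!₂[x, y] : Phase)‖ ^ 2 = x ^ 2 + y ^ 2 := by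
    simp [EuclideanSpace.norm_sq_eq, Fin.sum_univ_two]
  rw [e, sq, ← mul_inv, ← mul_inv]
  gcongr
  · nlinarith [sq_nonneg y]
  · nlinarith [sq_nonneg x]

theorem exists_norm_apply_le_mul_inv_mul_inv (f : 𝓢(Phase, ℂ)) :
    ∃ C : ℝ, ∀ x y : ℝ, ‖f !₂[x, y]‖ ≤ C * ((1 + x ^ 2)⁻¹ * (1 + y ^ 2)⁻¹) :=
  ⟨_, fun x y => (norm_apply_le_sup_seminorm_mul ℂ f 2 _).trans
    (mul_le_mul_of_nonneg_left (inv_one_add_norm_sq_le x y) (by positivity))⟩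

/- Peetre's inequality. -/
theorem inv_one_add_add_sq_le (x b : ℝ) :
    (1 + (x + b) ^ 2)⁻¹ ≤ 2 * (1 + b ^ 2) * (1 + x ^ 2)⁻¹ := by
  rw [← div_eq_mul_inv, inv_eq_one_div, div_le_div_iff₀ (by positivity) (by positivity)]
  nlinarith [sq_nonneg (x + 2 * b), mul_nonneg (sq_nonneg b) (sq_nonneg (x + b))]

theorem summable_inv_one_add_mul_sq {c : ℝ} (hc : c ≠ 0) :
    Summable fun n : ℤ => (1 + (c * n) ^ 2)⁻¹ := by
  refine Summable.of_norm_bounded_eventually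
    (((Real.summable_one_div_int_pow (p := 2)).2 one_lt_two).mul_left (c ^ 2)⁻¹) ?_
  filter_upwards [(Set.finite_singleton (0 : ℤ)).compl_mem_cofinite] with n hn
  have hn' : (n : ℝ) ≠ 0 := by exact_mod_cast hn
  rw [Real.norm_of_nonneg (by positivity), one_div, ← mul_inv, ← mul_pow]
  gcongr
  linarith

theorem summable_inv_one_add_affine_sq {c : ℝ} (hc : c ≠ 0) (b : ℝ) :
    Summable fun n : ℤ => (1 + (c * n + b) ^ 2)⁻¹ :=
  .of_nonneg_of_le (fun _ => by positivity) (fun _ => inv_one_add_add_sq_le _ _)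
    ((summable_inv_one_add_mul_sq hc).mul_left _)

theorem summable_inv_one_add_int_sq : Summable fun n : ℤ => (1 + (n : ℝ) ^ 2)⁻¹ := by
  simpa using summable_inv_one_add_mul_sq one_ne_zero

theorem summable_inv_one_add_sq_mul_inv_one_add_sq {c c' : ℝ} (hc : c ≠ 0) (hc' : c' ≠ 0) :
    Summable fun a : ℤ × ℤ => (1 + (c * a.1) ^ 2)⁻¹ * (1 + (c' * a.2) ^ 2)⁻¹ :=
  (summable_inv_one_add_mul_sq hc).mul_of_nonneg (summable_inv_one_add_mul_sq hc')
    (fun _ => by positivity) fun _ => by positivity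

theorem inv_one_add_sq_isBigO :
    (fun x : ℝ => (1 + x ^ 2)⁻¹) =O[cocompact ℝ] fun x : ℝ => |x| ^ (-2 : ℝ) := by
  refine Asymptotics.IsBigO.of_bound 1 ?_
  filter_upwards [(Set.finite_singleton (0 : ℝ)).isCompact.compl_mem_cocompact] with x hx
  have hx' : x ≠ 0 := hx
  rw [Real.norm_of_nonneg (by positivity), Real.norm_of_nonneg (by positivity), one_mul,
    Real.rpow_neg (abs_nonneg _), Real.rpow_two, sq_abs]
  gcongr
  linarith

end Decay

/-! ### Dirac combs -/

section DiracComb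

variable {ι E : Type*} [NormedAddCommGroup E] [NormedSpace ℝ E] {c : ι → ℂ} {x : ι → E} {n : ℕ}

theorem norm_mul_apply_le (c : ℂ) (x : E) (n : ℕ) (f : 𝓢(E, ℂ)) :
    ‖c * f x‖ ≤ ‖c‖ * ((1 + ‖x‖ ^ 2)⁻¹) ^ n *
      (2 ^ (2 * n) * (Finset.Iic (2 * n, 0)).sup (schwartzSeminormFamily ℂ E ℂ) f) := by
  rw [norm_mul, mul_assoc, mul_comm (_ ^ n)]
  gcongr
  exact norm_apply_le_sup_seminorm_mul ℂ f n x

theorem summable_mul_apply (h : Summable fun i => ‖c i‖ * ((1 + ‖x i‖ ^ 2)⁻¹) ^ n)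
    (f : 𝓢(E, ℂ)) : Summable fun i => c i * f (x i) :=
  .of_norm_bounded (h.mul_right _) fun i => norm_mul_apply_le (c i) (x i) n f

/-- The tempered distribution `∑ᵢ cᵢ δ(· - xᵢ)`, for weights of polynomial growth along the points
`xᵢ`. -/
noncomputable def diracComb (c : ι → ℂ) (x : ι → E) (n : ℕ)
    (h : Summable fun i => ‖c i‖ * ((1 + ‖x i‖ ^ 2)⁻¹) ^ n) : 𝓢'(E, ℂ) :=
  ContinuousLinearMap.toPointwiseConvergenceCLM _ _ _ _ <|
    mkCLMtoNormedSpace (σ := RingHom.id ℂ) (fun f : 𝓢(E, ℂ) => ∑' i, c i * f (x i))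
      (fun f f' => by
        simp only [add_apply, mul_add]
        exact (summable_mul_apply h f).tsum_add (summable_mul_apply h f'))
      (fun a f => by
        simp only [smul_apply, smul_eq_mul, RingHom.id_apply, mul_left_comm _ a]
        rw [tsum_mul_left])
      ⟨Finset.Iic (2 * n, 0), (∑' i, ‖c i‖ * ((1 + ‖x i‖ ^ 2)⁻¹) ^ n) * 2 ^ (2 * n),
        by positivity, fun f =>
          (tsum_of_norm_bounded (h.hasSum.mul_right _) fun i => norm_mul_apply_le _ _ n f).trans
            (le_of_eq (mul_assoc _ _ _).symm)⟩

theorem diracComb_apply (h : Summable fun i => ‖c i‖ * ((1 + ‖x i‖ ^ 2)⁻¹) ^ n) (f : 𝓢(E, ℂ)) :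
    diracComb c x n h f = ∑' i, c i * f (x i) := rfl

theorem hasSum_diracComb (h : Summable fun i => ‖c i‖ * ((1 + ‖x i‖ ^ 2)⁻¹) ^ n) :
    HasSum (fun i => c i • TemperedDistribution.delta (x i)) (diracComb c x n h) := by
  refine PointwiseConvergenceCLM.tendsto_iff_forall_tendsto.2 fun f => ?_
  refine (summable_mul_apply h f).hasSum.congr fun s => ?_
  simp [sum_apply]

end DiracComb

section LatticeComb

variable {d : ℕ} [NeZero d]

theorem summable_norm_mul_latticeWeight (w : ZMod d × ZMod d → ℂ) :
    Summable fun a : ℤ × ℤ => ‖w ((a.1 : ZMod d), (a.2 : ZMod d))‖ *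
      ((1 + ‖latticePoint d a‖ ^ 2)⁻¹) ^ 2 := by
  have hl := (ell_pos d).ne'
  refine .of_nonneg_of_le (fun _ => by positivity) (fun a => ?_)
    ((summable_inv_one_add_sq_mul_inv_one_add_sq hl hl).mul_left (∑ s, ‖w s‖))
  gcongr
  · exact Finset.single_le_sum (f := fun s => ‖w s‖) (fun _ _ => norm_nonneg _)
      (Finset.mem_univ _)
  · exact inv_one_add_norm_sq_le _ _

/-- The tempered distribution `∑ₐ w(a mod d) δ(η - ℓ a)`. -/
noncomputable def latticeComb (w : ZMod d × ZMod d → ℂ) : 𝓢'(Phase, ℂ) :=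
  diracComb _ _ 2 (summable_norm_mul_latticeWeight w)

theorem latticeComb_apply (w : ZMod d × ZMod d → ℂ) (f : 𝓢(Phase, ℂ)) :
    latticeComb w f = ∑' a : ℤ × ℤ, w ((a.1 : ZMod d), (a.2 : ZMod d)) * f (latticePoint d a) :=
  diracComb_apply _ f

theorem hasSum_latticeComb (w : ZMod d × ZMod d → ℂ) :
    HasSum (fun a : ℤ × ℤ => w ((a.1 : ZMod d), (a.2 : ZMod d)) •
      TemperedDistribution.delta (latticePoint d a)) (latticeComb w) :=
  hasSum_diracComb _

theorem isNonneg_latticeComb {w : ZMod d × ZMod d → ℂ} (hw : ∀ t, 0 ≤ w t) :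
    IsNonneg (latticeComb w) := fun f hf => by
  rw [latticeComb_apply]
  exact tsum_nonneg fun a => mul_nonneg (hw _) (hf _)

end LatticeComb

/-! ### Poisson summation -/

section Poisson

open scoped FourierTransform RealInnerProductSpace

theorem fourier_comp_smul_add {V E : Type*} [NormedAddCommGroup V] [InnerProductSpace ℝ V]
    [FiniteDimensional ℝ V] [MeasurableSpace V] [BorelSpace V] [NormedAddCommGroup E]
    [NormedSpace ℂ E] (f : V → E) {L : ℝ} (hL : L ≠ 0) (x₀ w : V) :
    𝓕 (fun v => f (L • v + x₀)) w =
      |(L ^ Module.finrank ℝ V)⁻¹| • 𝐞 ⟪x₀, L⁻¹ • w⟫ • 𝓕 f (L⁻¹ • w) := by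
  let φ : V → E := fun u => 𝐞 ⟪x₀, L⁻¹ • w⟫ • 𝐞 (-⟪u, L⁻¹ • w⟫) • f u
  have e (v : V) : 𝐞 (-⟪v, w⟫) • f (L • v + x₀) = φ (L • v + x₀) := by
    simp only [φ]
    rw [smul_smul, ← AddChar.map_add_eq_mul]
    congr 3
    simp only [inner_add_left, real_inner_smul_left, real_inner_smul_right]
    field_simp
    ring
  rw [Real.fourier_eq, Real.fourier_eq]
  simp_rw [e]
  rw [Measure.integral_comp_smul volume (fun v => φ (v + x₀)) L, integral_add_right_eq_self φ]
  simp_rw [φ, Circle.smul_def, integral_smul]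

theorem fourier_tsum {V E ι : Type*} [NormedAddCommGroup V] [InnerProductSpace ℝ V]
    [FiniteDimensional ℝ V] [MeasurableSpace V] [BorelSpace V] [NormedAddCommGroup E]
    [NormedSpace ℂ E] [Countable ι] {g : ι → V → E} (hg : ∀ i, Integrable (g i))
    (hs : Summable fun i => ∫ v, ‖g i v‖) (w : V) :
    𝓕 (fun v => ∑' i, g i v) w = ∑' i, 𝓕 (g i) w := by
  simp_rw [Real.fourier_eq]
  rw [integral_tsum_of_summable_integral_norm
    (fun i => (Real.fourierIntegral_convergent_iff w).2 (hg i)) (by simpa using hs)]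
  simp_rw [Circle.smul_def, tsum_const_smul'']

theorem continuous_fourier_of_dominated {V E X : Type*} [NormedAddCommGroup V]
    [InnerProductSpace ℝ V] [FiniteDimensional ℝ V] [MeasurableSpace V] [BorelSpace V]
    [NormedAddCommGroup E] [NormedSpace ℂ E] [TopologicalSpace X] [FirstCountableTopology X]
    {g : X → V → E} (hg : Continuous (Function.uncurry g)) {b : V → ℝ} (hb : Integrable b)
    (hgb : ∀ x v, ‖g x v‖ ≤ b v) (w : V) :
    Continuous fun x => 𝓕 (g x) w := by
  have hint (x : X) : Integrable (g x) :=
    hb.mono' (hg.comp (by fun_prop : Continuous fun v => (x, v))).aestronglyMeasurable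
      (.of_forall (hgb x))
  simp_rw [Real.fourier_eq]
  refine continuous_of_dominated (bound := b)
    (fun x => ((Real.fourierIntegral_convergent_iff w).2 (hint x)).aestronglyMeasurable)
    (fun x => .of_forall fun v => ?_) hb (.of_forall fun v => ?_)
  · rw [Circle.norm_smul]
    exact hgb x v
  · exact (hg.comp (by fun_prop : Continuous fun x => (x, v))).const_smul _

theorem norm_fourier_le_integral {V E : Type*} [NormedAddCommGroup V]
    [InnerProductSpace ℝ V] [FiniteDimensional ℝ V] [MeasurableSpace V] [BorelSpace V]
    [NormedAddCommGroup E] [NormedSpace ℂ E] {f : V → E} {b : V → ℝ} (hb : Integrable b)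
    (hf : ∀ v, ‖f v‖ ≤ b v) (w : V) : ‖𝓕 f w‖ ≤ ∫ v, b v := by
  rw [Real.fourier_eq]
  exact norm_integral_le_of_norm_le hb (.of_forall fun v => by rw [Circle.norm_smul]; exact hf v)

theorem tsum_int_eq_tsum_fourier {f : ℝ → ℂ} (hf : Continuous f) {C : ℝ}
    (hC : ∀ x, ‖f x‖ ≤ C * (1 + x ^ 2)⁻¹) (hs : Summable fun n : ℤ => 𝓕 f n) :
    ∑' n : ℤ, f n = ∑' n : ℤ, 𝓕 f n := by
  have hO : f =O[cocompact ℝ] fun x : ℝ => |x| ^ (-2 : ℝ) :=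
    (Asymptotics.IsBigO.of_bound C (.of_forall fun x => by
      rw [Real.norm_of_nonneg (by positivity)]
      exact hC x)).trans inv_one_add_sq_isBigO
  simpa using Real.tsum_eq_tsum_fourier_of_rpow_decay_of_summable hf one_lt_two hO hs 0

/-- The Fourier transform of `F` in its first variable. -/
noncomputable def partialFourier (F : ℝ → ℝ → ℂ) (m y : ℝ) : ℂ := 𝓕 (fun x => F x y) m

section ProductDecay

variable {F : ℝ → ℝ → ℂ} {C : ℝ}

theorem nonneg_of_norm_le_mul_inv_mul_inv
    (hC : ∀ x y, ‖F x y‖ ≤ C * ((1 + x ^ 2)⁻¹ * (1 + y ^ 2)⁻¹)) : 0 ≤ C := by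
  simpa using (norm_nonneg _).trans (hC 0 0)

theorem norm_partialFourier_le
    (hC : ∀ x y, ‖F x y‖ ≤ C * ((1 + x ^ 2)⁻¹ * (1 + y ^ 2)⁻¹)) (m y : ℝ) :
    ‖partialFourier F m y‖ ≤ C * Real.pi * (1 + y ^ 2)⁻¹ := by
  refine (norm_fourier_le_integral (integrable_inv_one_add_sq.const_mul (C * (1 + y ^ 2)⁻¹))
    (fun x => (hC x y).trans_eq (by ring)) m).trans_eq ?_
  rw [integral_const_mul, integral_univ_inv_one_add_sq]
  ring

theorem continuous_partialFourier (hF : Continuous (Function.uncurry F))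
    (hC : ∀ x y, ‖F x y‖ ≤ C * ((1 + x ^ 2)⁻¹ * (1 + y ^ 2)⁻¹))
    (m : ℝ) : Continuous (partialFourier F m) := by
  have hC0 := nonneg_of_norm_le_mul_inv_mul_inv hC
  refine continuous_fourier_of_dominated (g := fun y x => F x y) (hF.comp continuous_swap)
    (integrable_inv_one_add_sq.const_mul C) (fun y x => (hC x y).trans ?_) m
  gcongr
  exact mul_le_of_le_one_right (by positivity) (inv_le_one_of_one_le₀ (by nlinarith))

theorem integrable_of_norm_le_mul_inv_mul_inv (hF : Continuous (Function.uncurry F))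
    (hC : ∀ x y, ‖F x y‖ ≤ C * ((1 + x ^ 2)⁻¹ * (1 + y ^ 2)⁻¹))
    (y : ℝ) : Integrable fun x => F x y :=
  (integrable_inv_one_add_sq.const_mul (C * (1 + y ^ 2)⁻¹)).mono'
    (hF.comp (by fun_prop : Continuous fun x : ℝ => (x, y))).aestronglyMeasurable
    (.of_forall fun x => (hC x y).trans_eq (by ring))

theorem fourier_tsum_int (hF : Continuous (Function.uncurry F))
    (hC : ∀ x y, ‖F x y‖ ≤ C * ((1 + x ^ 2)⁻¹ * (1 + y ^ 2)⁻¹)) (m : ℝ) :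
    𝓕 (fun x => ∑' n : ℤ, F x n) m = ∑' n : ℤ, partialFourier F m n := by
  have hint (n : ℤ) := integrable_of_norm_le_mul_inv_mul_inv hF hC n
  refine fourier_tsum hint (.of_nonneg_of_le (fun n => by positivity) (fun n => ?_)
    (summable_inv_one_add_int_sq.mul_left (C * Real.pi))) m
  calc ∫ x, ‖F x n‖ ≤ ∫ x : ℝ, C * (1 + (n : ℝ) ^ 2)⁻¹ * (1 + x ^ 2)⁻¹ :=
        integral_mono (hint n).norm (integrable_inv_one_add_sq.const_mul _)
          fun x => (hC x n).trans_eq (by ring)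
    _ = C * Real.pi * (1 + (n : ℝ) ^ 2)⁻¹ := by
        rw [integral_const_mul, integral_univ_inv_one_add_sq]
        ring

theorem continuous_tsum_int (hF : Continuous (Function.uncurry F))
    (hC : ∀ x y, ‖F x y‖ ≤ C * ((1 + x ^ 2)⁻¹ * (1 + y ^ 2)⁻¹)) :
    Continuous fun x => ∑' n : ℤ, F x n := by
  have hC0 := nonneg_of_norm_le_mul_inv_mul_inv hC
  refine continuous_tsum (fun n => hF.comp (by fun_prop : Continuous fun x : ℝ => (x, (n : ℝ))))
    (summable_inv_one_add_int_sq.mul_left C) fun n x => (hC x n).trans ?_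
  gcongr
  exact mul_le_of_le_one_left (by positivity) (inv_le_one_of_one_le₀ (by nlinarith))

theorem norm_tsum_int_le
    (hC : ∀ x y, ‖F x y‖ ≤ C * ((1 + x ^ 2)⁻¹ * (1 + y ^ 2)⁻¹)) (x : ℝ) :
    ‖∑' n : ℤ, F x n‖ ≤ C * (∑' n : ℤ, (1 + (n : ℝ) ^ 2)⁻¹) * (1 + x ^ 2)⁻¹ := by
  refine (tsum_of_norm_bounded (summable_inv_one_add_int_sq.mul_left (C * (1 + x ^ 2)⁻¹)).hasSum
    fun n => (hC x n).trans_eq (by ring)).trans_eq ?_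
  rw [tsum_mul_left]
  ring

theorem tsum_tsum_eq_tsum_tsum_fourier (hF : Continuous (Function.uncurry F))
    (hC : ∀ x y, ‖F x y‖ ≤ C * ((1 + x ^ 2)⁻¹ * (1 + y ^ 2)⁻¹))
    (hs : Summable fun a : ℤ × ℤ => 𝓕 (partialFourier F a.1) a.2) :
    ∑' m : ℤ, ∑' n : ℤ, F m n = ∑' m : ℤ, ∑' n : ℤ, 𝓕 (partialFourier F m) n := by
  have hrow (m : ℤ) : 𝓕 (fun x => ∑' n : ℤ, F x n) m = ∑' n : ℤ, 𝓕 (partialFourier F m) n := by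
    rw [fourier_tsum_int hF hC, tsum_int_eq_tsum_fourier (continuous_partialFourier hF hC m)
      (norm_partialFourier_le hC m) (hs.prod_factor m)]
  rw [tsum_int_eq_tsum_fourier (continuous_tsum_int hF hC) (norm_tsum_int_le hC)
    (by simpa only [hrow] using hs.prod)]
  simp_rw [hrow]

end ProductDecay

theorem integral_phase {E : Type*} [NormedAddCommGroup E] [NormedSpace ℝ E] {f : Phase → E}
    (hf : Integrable f) : ∫ η, f η = ∫ y : ℝ, ∫ x : ℝ, f !₂[x, y] := by
  have hL := PiLp.volume_preserving_toLp (Fin 2)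
  have hLe := (MeasurableEquiv.toLp 2 (Fin 2 → ℝ)).measurableEmbedding
  have hA := (volume_preserving_finTwoArrow ℝ).symm
  have hAe := (MeasurableEquiv.finTwoArrow (α := ℝ)).symm.measurableEmbedding
  have hf' : Integrable (fun p : ℝ × ℝ => f !₂[p.1, p.2]) (volume.prod volume) :=
    (hA.integrable_comp_emb hAe (g := fun v : Fin 2 → ℝ => f (WithLp.toLp 2 v))).2
      ((hL.integrable_comp_emb hLe).2 hf)
  rw [← hL.integral_comp hLe f, ← hA.integral_comp hAe (fun v => f (WithLp.toLp 2 v))]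
  exact integral_prod_symm _ hf'

theorem fourier_partialFourier {f : Phase → ℂ} (hf : Integrable f) (m n : ℝ) :
    𝓕 (partialFourier (fun x y => f !₂[x, y]) m) n = 𝓕 f !₂[m, n] := by
  have e (x y : ℝ) : 𝐞 (-⟪(!₂[x, y] : Phase), !₂[m, n]⟫) • f !₂[x, y] =
      𝐞 (-⟪y, n⟫) • 𝐞 (-⟪x, m⟫) • f !₂[x, y] := by
    rw [smul_smul, ← AddChar.map_add_eq_mul]
    congr 2
    simp [PiLp.inner_apply, Fin.sum_univ_two]
  change 𝓕 (fun y : ℝ => 𝓕 (fun x : ℝ => f !₂[x, y]) m) n = _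
  simp_rw [Real.fourier_eq]
  rw [integral_phase ((Real.fourierIntegral_convergent_iff _).2 hf)]
  simp_rw [e, Circle.smul_def, integral_smul]

theorem summable_norm_lattice (f : 𝓢(Phase, ℂ)) {c c' : ℝ} (hc : c ≠ 0) (hc' : c' ≠ 0) :
    Summable fun a : ℤ × ℤ => ‖f !₂[c * a.1, c' * a.2]‖ := by
  obtain ⟨C, hC⟩ := exists_norm_apply_le_mul_inv_mul_inv f
  exact .of_nonneg_of_le (fun _ => norm_nonneg _) (fun _ => hC _ _)
    ((summable_inv_one_add_sq_mul_inv_one_add_sq hc hc').mul_left C)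

theorem tsum_fourier_phase (f : 𝓢(Phase, ℂ)) :
    ∑' a : ℤ × ℤ, 𝓕 f !₂[(a.1 : ℝ), (a.2 : ℝ)] = ∑' b : ℤ × ℤ, f !₂[(b.1 : ℝ), (b.2 : ℝ)] := by
  obtain ⟨C, hC⟩ := exists_norm_apply_le_mul_inv_mul_inv f
  have hs (f : 𝓢(Phase, ℂ)) : Summable fun a : ℤ × ℤ => f !₂[(a.1 : ℝ), (a.2 : ℝ)] := by
    simpa using (summable_norm_lattice f one_ne_zero one_ne_zero).of_norm
  have hpf (m n : ℝ) : 𝓕 (partialFourier (fun x y => f !₂[x, y]) m) n = 𝓕 f !₂[m, n] := by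
    rw [fourier_partialFourier f.integrable, SchwartzMap.fourier_coe]
  rw [(hs _).tsum_prod, (hs f).tsum_prod,
    tsum_tsum_eq_tsum_tsum_fourier (F := fun x y => f !₂[x, y])
      (f.continuous.comp (by fun_prop : Continuous fun p : ℝ × ℝ => !₂[p.1, p.2])) hC]
  · simp_rw [hpf]
  · simp_rw [hpf]
    exact hs _

theorem tsum_affine_lattice (f : 𝓢(Phase, ℂ)) {L : ℝ} (hL : L ≠ 0) (x₀ : Phase) :
    ∑' b : ℤ × ℤ, f (L • !₂[(b.1 : ℝ), (b.2 : ℝ)] + x₀) =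
      (L ^ 2 : ℝ)⁻¹ * ∑' a : ℤ × ℤ, 𝐞 ⟪x₀, L⁻¹ • !₂[(a.1 : ℝ), (a.2 : ℝ)]⟫ •
        𝓕 f (L⁻¹ • !₂[(a.1 : ℝ), (a.2 : ℝ)]) := by
  let g : 𝓢(Phase, ℂ) := compCLMOfContinuousLinearEquiv ℂ
    (ContinuousLinearEquiv.smulLeft (Units.mk0 L hL) : Phase ≃L[ℝ] Phase)
      (compSubConstCLM ℂ (-x₀) f)
  have hg : (g : Phase → ℂ) = fun η => f (L • η + x₀) := by
    ext η
    simp [g, Units.smul_def]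
  have h𝓕g (w : Phase) : 𝓕 g w = (L ^ 2 : ℝ)⁻¹ * (𝐞 ⟪x₀, L⁻¹ • w⟫ • 𝓕 f (L⁻¹ • w)) := by
    rw [SchwartzMap.fourier_coe, hg, fourier_comp_smul_add f hL, finrank_euclideanSpace_fin,
      abs_of_nonneg (by positivity), Complex.real_smul, SchwartzMap.fourier_coe,
      Complex.ofReal_inv]
  have h := tsum_fourier_phase g
  simp_rw [h𝓕g, hg] at h
  rw [← h, tsum_mul_left]

end Poisson

/-! ### Riemann sums on the line -/

section RiemannSum

variable {E : Type*} [NormedAddCommGroup E] [NormedSpace ℝ E]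

theorem map_floor_volume :
    (volume : Measure ℝ).map (Int.floor : ℝ → ℤ) = Measure.count := by
  refine Measure.ext_of_singleton fun n => ?_
  rw [Measure.map_apply Int.measurable_floor (measurableSet_singleton n),
    Int.preimage_floor_singleton, Real.volume_Ico, Measure.count_singleton]
  simp

theorem integral_comp_floor [CompleteSpace E] {F : ℤ → E} (hF : Summable fun n => ‖F n‖) :
    ∫ x : ℝ, F ⌊x⌋ = ∑' n, F n := by
  have hm : AEStronglyMeasurable F ((volume : Measure ℝ).map (Int.floor : ℝ → ℤ)) :=
    StronglyMeasurable.of_discrete.aestronglyMeasurable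
  rw [← integral_map (φ := (Int.floor : ℝ → ℤ)) Int.measurable_floor.aemeasurable hm,
    map_floor_volume, integral_countable (integrable_count_iff.2 hF)]
  simp

theorem integral_comp_floor_div [CompleteSpace E] {F : ℤ → E} (hF : Summable fun n => ‖F n‖)
    {t : ℝ} (ht : 0 < t) : ∫ x : ℝ, F ⌊x / t⌋ = t • ∑' n, F n := by
  rw [Measure.integral_comp_div (fun y : ℝ => F ⌊y⌋), abs_of_pos ht, integral_comp_floor hF]

/-- The point of the shifted grid `ε (s ℤ + γ)` whose index is that of the cell of `ε s ℤ`
containing `x`; Riemann sums over the shifted grid are integrals of functions of it. -/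
noncomputable def gridPoint (s γ ε x : ℝ) : ℝ := ε * (s * ⌊x / (ε * s)⌋ + γ)

theorem measurable_gridPoint (s γ ε : ℝ) : Measurable (gridPoint s γ ε) := by
  have : Measurable fun x : ℝ => ((⌊x / (ε * s)⌋ : ℤ) : ℝ) :=
    measurable_from_top.comp (Int.measurable_floor.comp (measurable_id.div_const _))
  exact ((this.const_mul s).add_const γ).const_mul ε

theorem abs_gridPoint_sub_le {s ε : ℝ} (hs : 0 < s) (hε : 0 < ε) (γ x : ℝ) :
    |gridPoint s γ ε x - x| ≤ ε * (s + |γ|) := by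
  have hεs : 0 < ε * s := mul_pos hε hs
  have hfloor : |⌊x / (ε * s)⌋ * (ε * s) - x| ≤ ε * s := by
    rw [abs_sub_comm, abs_of_nonneg (Int.sub_floor_div_mul_nonneg x hεs)]
    exact (Int.sub_floor_div_mul_lt x hεs).le
  calc |gridPoint s γ ε x - x|
      = |(⌊x / (ε * s)⌋ * (ε * s) - x) + ε * γ| := by rw [gridPoint]; ring_nf
    _ ≤ |⌊x / (ε * s)⌋ * (ε * s) - x| + |ε * γ| := abs_add_le _ _
    _ ≤ ε * s + ε * |γ| := by rw [abs_mul, abs_of_pos hε]; gcongr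
    _ = ε * (s + |γ|) := (mul_add _ _ _).symm

theorem tendsto_mul_const_nhdsGT_zero (c : ℝ) :
    Tendsto (fun ε : ℝ => ε * c) (𝓝[>] 0) (𝓝 0) :=
  Tendsto.mono_left ((continuous_mul_const c).tendsto' 0 0 (zero_mul c)) nhdsWithin_le_nhds

theorem tendsto_gridPoint {s : ℝ} (hs : 0 < s) (γ x : ℝ) :
    Tendsto (fun ε => gridPoint s γ ε x) (𝓝[>] 0) (𝓝 x) := by
  refine tendsto_iff_norm_sub_tendsto_zero.2 (squeeze_zero' (.of_forall fun _ => norm_nonneg _)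
    ?_ (tendsto_mul_const_nhdsGT_zero (s + |γ|)))
  filter_upwards [self_mem_nhdsWithin] with ε hε using abs_gridPoint_sub_le hs hε γ x

theorem inv_one_add_sq_le_of_abs_sub_le_one {x y : ℝ} (h : |y - x| ≤ 1) :
    (1 + y ^ 2)⁻¹ ≤ 4 * (1 + x ^ 2)⁻¹ := by
  have hsq : (y - x) ^ 2 ≤ 1 := (sq_le_one_iff_abs_le_one _).2 h
  calc (1 + y ^ 2)⁻¹ = (1 + (x + (y - x)) ^ 2)⁻¹ := by ring_nf
    _ ≤ 2 * (1 + (y - x) ^ 2) * (1 + x ^ 2)⁻¹ := inv_one_add_add_sq_le x (y - x)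
    _ ≤ 2 * (1 + 1) * (1 + x ^ 2)⁻¹ := by gcongr
    _ = 4 * (1 + x ^ 2)⁻¹ := by norm_num

variable {Φ : ℝ → ℝ → E} {C s : ℝ}

theorem tendsto_integral_gridPoint (hΦ : Continuous (Function.uncurry Φ))
    (hC : ∀ x y, ‖Φ x y‖ ≤ C * (1 + y ^ 2)⁻¹) (hs : 0 < s) (α β : ℝ) :
    Tendsto (fun ε => ∫ x, Φ (gridPoint s α ε x) (gridPoint s β ε x)) (𝓝[>] 0)
      (𝓝 (∫ x, Φ x x)) := by
  have hC0 : 0 ≤ C := by simpa using (norm_nonneg _).trans (hC 0 0)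
  have hε : ∀ᶠ ε : ℝ in 𝓝[>] 0, ε * (s + |β|) ≤ 1 :=
    (tendsto_mul_const_nhdsGT_zero _).eventually_le_const one_pos
  refine tendsto_integral_filter_of_dominated_convergence (fun x => C * (4 * (1 + x ^ 2)⁻¹))
    (.of_forall fun ε => ?_) ?_ ((integrable_inv_one_add_sq.const_mul 4).const_mul C)
    (.of_forall fun x => (hΦ.tendsto (x, x)).comp
      ((tendsto_gridPoint hs α x).prodMk_nhds (tendsto_gridPoint hs β x)))
  · exact (hΦ.stronglyMeasurable.comp_measurable ((measurable_gridPoint s α ε).prodMk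
      (measurable_gridPoint s β ε))).aestronglyMeasurable
  · filter_upwards [hε, self_mem_nhdsWithin] with ε hε1 hε0
    refine .of_forall fun x => (hC _ _).trans ?_
    gcongr
    exact inv_one_add_sq_le_of_abs_sub_le_one ((abs_gridPoint_sub_le hs hε0 β x).trans hε1)

theorem tendsto_riemannSum [CompleteSpace E] (hΦ : Continuous (Function.uncurry Φ))
    (hC : ∀ x y, ‖Φ x y‖ ≤ C * (1 + y ^ 2)⁻¹) (hs : 0 < s) (α β : ℝ) :
    Tendsto (fun ε : ℝ => ε • ∑' n : ℤ, Φ (ε * (s * n + α)) (ε * (s * n + β)))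
      (𝓝[>] 0) (𝓝 (s⁻¹ • ∫ x, Φ x x)) := by
  refine ((tendsto_integral_gridPoint hΦ hC hs α β).const_smul s⁻¹).congr' ?_
  filter_upwards [self_mem_nhdsWithin] with ε hε
  have hεs : 0 < ε * s := mul_pos hε hs
  have hsum : Summable fun n : ℤ => ‖Φ (ε * (s * n + α)) (ε * (s * n + β))‖ := by
    refine .of_nonneg_of_le (fun _ => norm_nonneg _) (fun n => hC _ _) (.mul_left C ?_)
    simpa only [mul_add, ← mul_assoc] using summable_inv_one_add_affine_sq hεs.ne' (ε * β)
  change s⁻¹ • ∫ x, (fun n : ℤ => Φ (ε * (s * n + α)) (ε * (s * n + β))) ⌊x / (ε * s)⌋ = _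
  rw [integral_comp_floor_div hsum hεs, smul_smul]
  congr 1
  field_simp

end RiemannSum

/-! ### Overlaps of displaced wave packets -/

section Overlap

/-- The overlap of the wave packet `δ^(-1/2) h (· / δ)` with its copy modulated by `c` and then
translated by `r`, in the variable `s = x / δ`. -/
noncomputable def overlap (h : 𝓢(ℝ, ℂ)) (c δ r : ℝ) : ℂ :=
  ∫ s, conj (h s) * (Complex.exp (Complex.I * c * (δ * s - r : ℝ)) * h (s - r / δ))

theorem norm_exp_I_mul_mul (c x : ℝ) : ‖Complex.exp (Complex.I * c * x)‖ = 1 := by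
  rw [mul_assoc, ← Complex.ofReal_mul, Complex.norm_exp_I_mul_ofReal]

theorem norm_overlap_integrand (h : 𝓢(ℝ, ℂ)) (c x s r : ℝ) :
    ‖conj (h s) * (Complex.exp (Complex.I * c * x) * h (s - r))‖ = ‖h s‖ * ‖h (s - r)‖ := by
  rw [norm_mul, norm_mul, norm_exp_I_mul_mul, one_mul, RCLike.norm_conj]

theorem exists_norm_mul_norm_comp_sub_le (h : 𝓢(ℝ, ℂ)) :
    ∃ C : ℝ, ∀ s r, ‖h s‖ * ‖h (s - r)‖ ≤ C * (1 + r ^ 2)⁻¹ * (1 + s ^ 2)⁻¹ := by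
  obtain ⟨C, hC⟩ : ∃ C : ℝ, ∀ s, ‖h s‖ ≤ C * ((1 + s ^ 2)⁻¹) ^ 2 :=
    ⟨_, fun s => by simpa using norm_apply_le_sup_seminorm_mul ℂ h 2 s⟩
  obtain ⟨C', hC'⟩ := exists_norm_apply_le_mul_inv_one_add_sq h
  have hC0 : 0 ≤ C := by simpa using (norm_nonneg _).trans (hC 0)
  have hC'0 : 0 ≤ C' := by simpa using (norm_nonneg _).trans (hC' 0)
  refine ⟨C * (C' * 2), fun s r => ?_⟩
  have peetre : (1 + (s - r) ^ 2)⁻¹ ≤ 2 * (1 + s ^ 2) * (1 + r ^ 2)⁻¹ := by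
    simpa [neg_add_eq_sub] using inv_one_add_add_sq_le (-r) s
  calc ‖h s‖ * ‖h (s - r)‖
      ≤ C * ((1 + s ^ 2)⁻¹) ^ 2 * (C' * (2 * (1 + s ^ 2) * (1 + r ^ 2)⁻¹)) :=
        mul_le_mul (hC s) ((hC' _).trans (mul_le_mul_of_nonneg_left peetre hC'0))
          (norm_nonneg _) (by positivity)
    _ = C * (C' * 2) * (1 + r ^ 2)⁻¹ * (1 + s ^ 2)⁻¹ := by field_simp

theorem exists_norm_overlap_le (h : 𝓢(ℝ, ℂ)) :
    ∃ C : ℝ, 0 ≤ C ∧ ∀ c δ r : ℝ, ‖overlap h c δ r‖ ≤ C * (1 + (r / δ) ^ 2)⁻¹ := by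
  obtain ⟨C, hC⟩ := exists_norm_mul_norm_comp_sub_le h
  have hC0 : 0 ≤ C := by
    simpa using (mul_nonneg (norm_nonneg (h 0)) (norm_nonneg (h (0 - 0)))).trans (hC 0 0)
  refine ⟨C * Real.pi, by positivity, fun c δ r => ?_⟩
  calc ‖overlap h c δ r‖
      ≤ ∫ s : ℝ, C * (1 + (r / δ) ^ 2)⁻¹ * (1 + s ^ 2)⁻¹ :=
        norm_integral_le_of_norm_le (integrable_inv_one_add_sq.const_mul _)
          (.of_forall fun s => (norm_overlap_integrand h c _ s _).trans_le (hC s _))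
    _ = C * Real.pi * (1 + (r / δ) ^ 2)⁻¹ := by
        rw [integral_const_mul, integral_univ_inv_one_add_sq]
        ring

theorem tendsto_overlap_zero (h : 𝓢(ℝ, ℂ)) (c : ℝ) :
    Tendsto (fun δ => overlap h c δ 0) (𝓝[>] 0) (𝓝 (∫ s, conj (h s) * h s)) := by
  obtain ⟨C, hC⟩ := exists_norm_mul_norm_comp_sub_le h
  simp only [overlap, zero_div]
  refine tendsto_integral_filter_of_dominated_convergence
    (fun s => C * (1 + 0 ^ 2)⁻¹ * (1 + s ^ 2)⁻¹)
    (.of_forall fun δ => Continuous.aestronglyMeasurable (by fun_prop))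
    (.of_forall fun δ => .of_forall fun s => (norm_overlap_integrand h c _ s 0).trans_le (hC s 0))
    (integrable_inv_one_add_sq.const_mul _) (.of_forall fun s => ?_)
  have hcont : Continuous fun δ : ℝ =>
      conj (h s) * (Complex.exp (Complex.I * c * (δ * s - 0 : ℝ)) * h (s - 0)) := by fun_prop
  simpa using (hcont.tendsto 0).mono_left nhdsWithin_le_nhds

theorem tendsto_overlap_of_ne_zero (h : 𝓢(ℝ, ℂ)) (c : ℝ) {r : ℝ} (hr : r ≠ 0) :
    Tendsto (fun δ => overlap h c δ r) (𝓝[>] 0) (𝓝 0) := by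
  obtain ⟨C, hC0, hC⟩ := exists_norm_overlap_le h
  have hlim : Tendsto (fun δ : ℝ => C * (δ ^ 2 / r ^ 2)) (𝓝[>] 0) (𝓝 0) := by
    have hcont : Continuous fun δ : ℝ => C * (δ ^ 2 / r ^ 2) := by fun_prop
    simpa using (hcont.tendsto 0).mono_left nhdsWithin_le_nhds
  refine squeeze_zero_norm' ?_ hlim
  filter_upwards [self_mem_nhdsWithin] with δ hδ
  have hδ : 0 < δ := hδ
  refine (hC c δ r).trans (mul_le_mul_of_nonneg_left ?_ hC0)
  rw [← div_pow, ← inv_div r δ, inv_pow]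
  exact inv_anti₀ (by positivity) (le_add_of_nonneg_left zero_le_one)

theorem tendsto_overlap (h : 𝓢(ℝ, ℂ)) (c r : ℝ) :
    Tendsto (fun δ => overlap h c δ r) (𝓝[>] 0)
      (𝓝 (if r = 0 then ∫ s, conj (h s) * h s else 0)) := by
  split_ifs with hr
  · exact hr ▸ tendsto_overlap_zero h c
  · exact tendsto_overlap_of_ne_zero h c hr

end Overlap

/-! ### Displacements -/

section Displacement

theorem ae_eq_comp_sub {f g : ℝ → ℂ} (h : f =ᵐ[volume] g) (c : ℝ) :
    (fun x => f (x - c)) =ᵐ[volume] fun x => g (x - c) :=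
  (measurePreserving_sub_right volume c).quasiMeasurePreserving.ae_eq_comp h

theorem translation_coeFn (c : ℝ) (F : Mode) :
    (translation c F : ℝ → ℂ) =ᵐ[volume] fun x => F (x - c) :=
  Lp.coeFn_compMeasurePreserving F (measurePreserving_sub_right volume c)

theorem norm_translation (c : ℝ) (F : Mode) : ‖translation c F‖ = ‖F‖ :=
  (Lp.compMeasurePreservingₗᵢ ℂ (fun x : ℝ => x - c)
    (measurePreserving_sub_right volume c)).norm_map F

theorem translation_zero (F : Mode) : translation 0 F = F := by
  refine Lp.ext ?_
  filter_upwards [translation_coeFn 0 F] with x hx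
  rw [hx, sub_zero]

theorem translation_translation (c c' : ℝ) (F : Mode) :
    translation c (translation c' F) = translation (c + c') F := by
  refine Lp.ext ?_
  filter_upwards [translation_coeFn c (translation c' F), translation_coeFn (c + c') F,
    ae_eq_comp_sub (translation_coeFn c' F) c] with x h h' h''
  rw [h, h', h'', sub_sub]

theorem inner_translation_translation (c c' : ℝ) (F G : Mode) :
    inner ℂ (translation c F) (translation c' G) = inner ℂ F (translation (c' - c) G) := by
  have h : inner ℂ (translation c F) (translation c (translation (c' - c) G)) =
      inner ℂ F (translation (c' - c) G) :=
    (Lp.compMeasurePreservingₗᵢ ℂ (fun x : ℝ => x - c)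
      (measurePreserving_sub_right volume c)).inner_map_map F _
  rwa [translation_translation, add_sub_cancel] at h

theorem modulation_coeFn (c : ℝ) (F : Mode) :
    (modulation c F : ℝ → ℂ) =ᵐ[volume] fun x => Complex.exp (Complex.I * c * x) * F x := by
  filter_upwards [(ContinuousLinearMap.mul ℂ ℂ).coeFn_holder (r := 2) (memLp_phase c).toLp F,
    (memLp_phase c).coeFn_toLp] with x hx hx'
  exact hx.trans (by rw [hx']; rfl)

theorem norm_modulation (c : ℝ) (F : Mode) : ‖modulation c F‖ = ‖F‖ := by
  rw [Lp.norm_def, Lp.norm_def]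
  congr 1
  refine eLpNorm_congr_norm_ae ?_
  filter_upwards [modulation_coeFn c F] with x hx
  rw [hx, norm_mul, norm_exp_I_mul_mul, one_mul]

theorem modulation_zero (F : Mode) : modulation 0 F = F := by
  refine Lp.ext ?_
  filter_upwards [modulation_coeFn 0 F] with x hx
  simp [hx]

theorem modulation_translation (c r : ℝ) (F : Mode) :
    modulation c (translation r F) =
      Complex.exp (Complex.I * c * r) • translation r (modulation c F) := by
  refine Lp.ext ?_
  filter_upwards [modulation_coeFn c (translation r F), translation_coeFn r F,
    Lp.coeFn_smul (Complex.exp (Complex.I * c * r)) (translation r (modulation c F)),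
    translation_coeFn r (modulation c F), ae_eq_comp_sub (modulation_coeFn c F) r]
    with x h₁ h₂ h₃ h₄ h₅
  rw [h₁, h₂, h₃, Pi.smul_apply, h₄, h₅, smul_eq_mul, ← mul_assoc, ← Complex.exp_add]
  congr 2
  push_cast
  ring

theorem displacement_apply (d : ℕ) (a : ℝ × ℝ) (F : Mode) :
    displacement d a F = Complex.exp (Complex.I * Real.pi * a.1 * a.2 / d) •
      translation (ell d * a.1) (modulation (ell d * a.2) F) :=
  rfl

theorem norm_displacement_apply (d : ℕ) (a : ℝ × ℝ) (F : Mode) :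
    ‖displacement d a F‖ = ‖F‖ := by
  have hphase : Complex.I * Real.pi * a.1 * a.2 / d =
      Complex.I * Real.pi * (a.1 * a.2 / d : ℝ) := by
    push_cast; ring
  rw [displacement_apply, norm_smul, hphase, norm_exp_I_mul_mul, one_mul, norm_translation,
    norm_modulation]

theorem norm_displacement_le (d : ℕ) (a : ℝ × ℝ) : ‖displacement d a‖ ≤ 1 :=
  ContinuousLinearMap.opNorm_le_bound _ zero_le_one fun F => by
    rw [norm_displacement_apply, one_mul]

theorem displacement_zero (d : ℕ) : displacement d 0 = ContinuousLinearMap.id ℂ Mode := by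
  ext1 F
  simp [displacement_apply, translation_zero, modulation_zero]

end Displacement

/-! ### Mixtures -/

section Mixture

open InnerProductSpace

variable {ι : Type*} [Fintype ι]

/-- The operator `∑_{j,k} ρ_{jk} |u_j⟩⟨u_k|` encoding the matrix `ρ` in the vectors `u`. -/
noncomputable def mixture (ρ : Matrix ι ι ℂ) (u : ι → Mode) : Mode →L[ℂ] Mode :=
  ∑ j, ∑ k, ρ j k • rankOne ℂ (u j) (u k)

theorem mixture_apply (ρ : Matrix ι ι ℂ) (u : ι → Mode) (ψ : Mode) :
    mixture ρ u ψ = ∑ j, (∑ k, ρ j k * inner ℂ (u k) ψ) • u j := by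
  simp [mixture, Finset.sum_smul, mul_smul]

theorem trace_mixture_comp (ρ : Matrix ι ι ℂ) (u : ι → Mode) (B : Mode →L[ℂ] Mode) :
    trace (mixture ρ u ∘L B) = ∑ j, ∑ k, ρ j k * inner ℂ (u k) (B (u j)) := by
  refine HasSum.tsum_eq ?_
  set b := (exists_hilbertBasis ℂ Mode).choose_spec.choose
  have hb : ∀ i, inner ℂ (b i) ((mixture ρ u ∘L B) (b i)) =
      ∑ j, ∑ k, ρ j k * (inner ℂ (B.adjoint (u k)) (b i) * inner ℂ (b i) (u j)) := fun i => by
    simp [mixture, inner_sum, inner_smul_right, ContinuousLinearMap.adjoint_inner_left]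
  simp_rw [hb, ← ContinuousLinearMap.adjoint_inner_left B]
  exact hasSum_sum fun j _ => hasSum_sum fun k _ => (b.hasSum_inner_mul_inner _ _).mul_left _

theorem trace_smul_comp (c : ℂ) (A B : Mode →L[ℂ] Mode) :
    trace ((c • A) ∘L B) = c * trace (A ∘L B) := by
  simp [trace, inner_smul_right, tsum_mul_left]

theorem norm_trace_mixture_comp_le (ρ : Matrix ι ι ℂ) (u : ι → Mode) (B : Mode →L[ℂ] Mode) :
    ‖trace (mixture ρ u ∘L B)‖ ≤ (∑ j, ∑ k, ‖ρ j k‖) * (∑ i, ‖u i‖ ^ 2) * ‖B‖ := by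
  have hu : ∀ i, ‖u i‖ ^ 2 ≤ ∑ i, ‖u i‖ ^ 2 := fun i =>
    Finset.single_le_sum (f := fun i => ‖u i‖ ^ 2) (fun _ _ => sq_nonneg _) (Finset.mem_univ i)
  have hinner : ∀ j k, ‖inner ℂ (u k) (B (u j))‖ ≤ (∑ i, ‖u i‖ ^ 2) * ‖B‖ := fun j k =>
    calc ‖inner ℂ (u k) (B (u j))‖ ≤ ‖u k‖ * (‖B‖ * ‖u j‖) :=
          (norm_inner_le_norm _ _).trans (by gcongr; exact B.le_opNorm _)
      _ = ‖u k‖ * ‖u j‖ * ‖B‖ := by ring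
      _ ≤ (∑ i, ‖u i‖ ^ 2) * ‖B‖ := by
          gcongr
          linarith [two_mul_le_add_sq ‖u k‖ ‖u j‖, hu j, hu k]
  rw [trace_mixture_comp, mul_assoc, Finset.sum_mul]
  refine norm_sum_le_of_le _ fun j _ => ?_
  rw [Finset.sum_mul]
  refine norm_sum_le_of_le _ fun k _ => ?_
  rw [norm_mul]
  gcongr
  exact hinner j k

theorem integrable_conj_mul {u : Mode} {f : ℝ → ℂ} (hu : (u : ℝ → ℂ) =ᵐ[volume] f) (ψ : Mode) :
    Integrable fun y => conj (f y) * ψ y := by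
  refine (L2.integrable_inner (𝕜 := ℂ) u ψ).congr ?_
  filter_upwards [hu] with y hy
  rw [RCLike.inner_apply, hy, mul_comm]

theorem inner_eq_integral_conj_mul {u : Mode} {f : ℝ → ℂ} (hu : (u : ℝ → ℂ) =ᵐ[volume] f)
    (ψ : Mode) : inner ℂ u ψ = ∫ y, conj (f y) * ψ y := by
  rw [L2.inner_def]
  refine integral_congr_ae ?_
  filter_upwards [hu] with y hy
  rw [RCLike.inner_apply, hy, mul_comm]

theorem isIntegralOperator_mixture (ρ : Matrix ι ι ℂ) {u : ι → Mode} {v : ι → ℝ → ℂ}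
    (h : ∀ j, (u j : ℝ → ℂ) =ᵐ[volume] v j) :
    IsIntegralOperator (fun x y => ∑ j, ∑ k, ρ j k * (conj (v k y) * v j x)) (mixture ρ u) := by
  intro ψ
  have hint : ∀ x j k, Integrable fun y => ρ j k * v j x * (conj (v k y) * ψ y) := fun x j k =>
    (integrable_conj_mul (h k) ψ).const_mul _
  have hkernel : ∀ x y, (∑ j, ∑ k, ρ j k * (conj (v k y) * v j x)) * ψ y =
      ∑ j, ∑ k, ρ j k * v j x * (conj (v k y) * ψ y) := fun x y => by
    simp only [Finset.sum_mul]
    exact Finset.sum_congr rfl fun j _ => Finset.sum_congr rfl fun k _ => by ring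
  rw [mixture_apply]
  filter_upwards [Lp.coeFn_finsetSum Finset.univ
      fun j => (∑ k, ρ j k * inner ℂ (u k) ψ) • u j,
    ae_all_iff.2 fun j => Lp.coeFn_smul (∑ k, ρ j k * inner ℂ (u k) ψ) (u j),
    ae_all_iff.2 h] with x hsum hsmul hv
  simp_rw [hkernel]
  rw [hsum, Finset.sum_apply, integral_finsetSum _ fun j _ => integrable_finsetSum _ fun k _ =>
    hint x j k]
  refine Finset.sum_congr rfl fun j _ => ?_
  rw [hsmul, Pi.smul_apply, hv, smul_eq_mul, integral_finsetSum _ fun k _ => hint x j k,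
    Finset.sum_mul]
  refine Finset.sum_congr rfl fun k _ => ?_
  rw [integral_const_mul, inner_eq_integral_conj_mul (h k)]
  ring

theorem IsIntegralOperator.unique {k : ℝ → ℝ → ℂ} {A B : Mode →L[ℂ] Mode}
    (hA : IsIntegralOperator k A) (hB : IsIntegralOperator k B) : A = B :=
  ContinuousLinearMap.ext fun ψ => Lp.ext ((hA ψ).trans (hB ψ).symm)

end Mixture

/-! ### Regularized codewords -/

section Codeword

theorem dilate_apply (f : 𝓢(ℝ, ℂ)) {c : ℝ} (hc : c ≠ 0) (x : ℝ) : dilate f hc x = f (c * x) := by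
  simp [dilate, Units.smul_def]

/-- The regularized position eigenstate `δ⁻¹ h (· / δ)`, with the value `0` unless `0 < δ`. -/
noncomputable def wavePacket (h : 𝓢(ℝ, ℂ)) (δ : ℝ) : Mode :=
  if hδ : 0 < δ then (((δ : ℂ)⁻¹) • dilate h (inv_ne_zero hδ.ne')).toLp 2 else 0

theorem wavePacket_coeFn (h : 𝓢(ℝ, ℂ)) {δ : ℝ} (hδ : 0 < δ) :
    (wavePacket h δ : ℝ → ℂ) =ᵐ[volume] fun x => (δ : ℂ)⁻¹ * h (x / δ) := by
  rw [wavePacket, dif_pos hδ]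
  filter_upwards [((((δ : ℂ)⁻¹) • dilate h (inv_ne_zero hδ.ne')).coeFn_toLp 2)] with x hx
  rw [hx, smul_apply, dilate_apply, smul_eq_mul, inv_mul_eq_div δ x]

theorem inner_wavePacket (h : 𝓢(ℝ, ℂ)) {δ : ℝ} (hδ : 0 < δ) (c r : ℝ) :
    inner ℂ (wavePacket h δ) (translation r (modulation c (wavePacket h δ))) =
      (δ : ℂ)⁻¹ * overlap h c δ r := by
  let G : ℝ → ℂ := fun s => (δ : ℂ)⁻¹ * (δ : ℂ)⁻¹ *
    (conj (h s) * (Complex.exp (Complex.I * c * (δ * s - r : ℝ)) * h (s - r / δ)))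
  calc inner ℂ (wavePacket h δ) (translation r (modulation c (wavePacket h δ)))
      = ∫ x, G (x / δ) := by
        rw [L2.inner_def]
        refine integral_congr_ae ?_
        filter_upwards [wavePacket_coeFn h hδ, translation_coeFn r (modulation c (wavePacket h δ)),
          ae_eq_comp_sub (modulation_coeFn c (wavePacket h δ)) r,
          ae_eq_comp_sub (wavePacket_coeFn h hδ) r] with x h₁ h₂ h₃ h₄
        rw [RCLike.inner_apply, h₁, h₂, h₃, h₄]
        simp only [G, map_mul, map_inv₀, Complex.conj_ofReal, mul_div_cancel₀ x hδ.ne', sub_div]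
        ring
    _ = δ • ∫ s, G s := by rw [Measure.integral_comp_div, abs_of_pos hδ]
    _ = (δ : ℂ)⁻¹ * overlap h c δ r := by
        have hδ' : (δ : ℂ) ≠ 0 := by exact_mod_cast hδ.ne'
        rw [integral_const_mul, Complex.real_smul, overlap, ← mul_assoc,
          mul_inv_cancel_left₀ hδ']

theorem ell_mul_self (d : ℕ) : ell d * ell d = 2 * Real.pi / d := by
  rw [ell, Real.mul_self_sqrt (by positivity)]

variable {d : ℕ}

/-- The summand of the regularized codeword `E |j_GKP⟩` at the peak `(d n + j) ℓ`. -/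
noncomputable def codewordPeak (g h : 𝓢(ℝ, ℂ)) (ε δ : ℝ) (j : ZMod d) (n : ℤ) : Mode :=
  g (ε * gkpPoint d j n) • translation (gkpPoint d j n) (wavePacket h δ)

theorem codewordPeak_coeFn (g h : 𝓢(ℝ, ℂ)) {ε δ : ℝ} (hε : 0 < ε) (hδ : 0 < δ) (j : ZMod d)
    (n : ℤ) :
    (codewordPeak g h ε δ j n : ℝ → ℂ) =ᵐ[volume]
      fun x => regRow g h hε hδ x (gkpPoint d j n) := by
  filter_upwards [Lp.coeFn_smul (g (ε * gkpPoint d j n))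
      (translation (gkpPoint d j n) (wavePacket h δ)),
    translation_coeFn (gkpPoint d j n) (wavePacket h δ),
    ae_eq_comp_sub (wavePacket_coeFn h hδ) (gkpPoint d j n)] with x h₁ h₂ h₃
  rw [codewordPeak, h₁, Pi.smul_apply, h₂, h₃, regRow_apply, smul_eq_mul]
  ring

variable [NeZero d]

theorem summable_norm_envelope (g : 𝓢(ℝ, ℂ)) {ε : ℝ} (hε : 0 < ε) (j : ZMod d) :
    Summable fun n : ℤ => ‖g (ε * gkpPoint d j n)‖ := by
  simpa [dilate_apply] using (summable_gkp d j (dilate g hε.ne')).norm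

/-- The regularized codeword `E |j_GKP⟩`. -/
noncomputable def codeword (g h : 𝓢(ℝ, ℂ)) (ε δ : ℝ) (j : ZMod d) : Mode :=
  (1 / Real.sqrt (ell d) : ℂ) • ∑' n : ℤ, codewordPeak g h ε δ j n

theorem summable_norm_codewordPeak (g h : 𝓢(ℝ, ℂ)) {ε : ℝ} (hε : 0 < ε) (δ : ℝ) (j : ZMod d) :
    Summable fun n : ℤ => ‖codewordPeak g h ε δ j n‖ := by
  simp_rw [codewordPeak, norm_smul, norm_translation]
  exact (summable_norm_envelope g hε j).mul_right _

theorem codeword_coeFn (g h : 𝓢(ℝ, ℂ)) {ε δ : ℝ} (hε : 0 < ε) (hδ : 0 < δ) (j : ZMod d) :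
    (codeword g h ε δ j : ℝ → ℂ) =ᵐ[volume] fun x => gkpKet d j (regRow g h hε hδ x) := by
  have hsum : ∑' n, ‖codewordPeak g h ε δ j n‖ₑ ≠ ∞ := by
    simp_rw [enorm_eq_nnnorm]
    exact ENNReal.tsum_coe_ne_top_iff_summable.2
      (NNReal.summable_coe.1 (summable_norm_codewordPeak g h hε δ j))
  filter_upwards [Lp.coeFn_smul (1 / Real.sqrt (ell d) : ℂ) (∑' n, codewordPeak g h ε δ j n),
    Lp.coeFn_tsum hsum, ae_all_iff.2 (codewordPeak_coeFn g h hε hδ j)] with x hsmul htsum hpeak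
  rw [codeword, hsmul, Pi.smul_apply, htsum, smul_eq_mul]
  simp_rw [hpeak]
  rfl

theorem regKernel_gkpEncode (ρ : Matrix (ZMod d) (ZMod d) ℂ) (g h : 𝓢(ℝ, ℂ)) {ε δ : ℝ}
    (hε : 0 < ε) (hδ : 0 < δ) (x y : ℝ) :
    regKernel g h hε hδ (gkpEncode d ρ) x y = ∑ j, ∑ k, ρ j k *
      (conj (gkpKet d k (regRow g h hε hδ y)) * gkpKet d j (regRow g h hε hδ x)) := by
  have hconj : ∀ φ : 𝓢(ℝ, ℂ), schwartzConj (schwartzConj φ) = φ := fun φ => by ext x; simp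
  have hketBra : ∀ (u v : 𝓢'(ℝ, ℂ)) (φ χ : 𝓢(ℝ, ℂ)),
      ketBra u v φ χ = conj (v (schwartzConj φ)) * u χ := fun _ _ _ _ => rfl
  simp only [regKernel, gkpEncode, sum_apply, smul_apply, hketBra, hconj, smul_eq_mul]

theorem isIntegralOperator_mixture_codeword (ρ : Matrix (ZMod d) (ZMod d) ℂ) (g h : 𝓢(ℝ, ℂ))
    {ε δ : ℝ} (hε : 0 < ε) (hδ : 0 < δ) :
    IsIntegralOperator (regKernel g h hε hδ (gkpEncode d ρ)) (mixture ρ (codeword g h ε δ)) := by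
  have h' := isIntegralOperator_mixture ρ (codeword_coeFn (d := d) g h hε hδ)
  simp_rw [← regKernel_gkpEncode] at h'
  exact h'

end Codeword

/-! ### Matrix elements of displacements between regularized codewords -/

section MatrixElement

theorem inner_tsum_tsum {E : Type*} [NormedAddCommGroup E] [InnerProductSpace ℂ E]
    [CompleteSpace E] {A B : ℤ → E} (hA : Summable fun n => ‖A n‖) (hB : Summable fun n => ‖B n‖) :
    inner ℂ (∑' n, A n) (∑' n, B n) = ∑' q, ∑' n, inner ℂ (A (n - q)) (B n) := by
  have hsum : Summable fun p : ℤ × ℤ => inner ℂ (A p.1) (B p.2) :=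
    .of_norm_bounded (hA.mul_of_nonneg hB (fun _ => norm_nonneg _) fun _ => norm_nonneg _)
      fun p => norm_inner_le_norm _ _
  let shear : ℤ × ℤ ≃ ℤ × ℤ :=
    ⟨fun p => (p.2 - p.1, p.2), fun p => (p.2 - p.1, p.2), fun p => by simp, fun p => by simp⟩
  calc inner ℂ (∑' n, A n) (∑' n, B n) = ∑' m, inner ℂ (A m) (∑' n, B n) :=
        (hA.of_norm.hasSum.mapL (innerSLFlip ℂ (∑' n, B n))).tsum_eq.symm
    _ = ∑' m, ∑' n, inner ℂ (A m) (B n) :=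
        tsum_congr fun m => (hB.of_norm.hasSum.mapL (innerSL ℂ (A m))).tsum_eq.symm
    _ = ∑' p : ℤ × ℤ, inner ℂ (A p.1) (B p.2) := hsum.tsum_prod.symm
    _ = ∑' p : ℤ × ℤ, inner ℂ (A (p.2 - p.1)) (B p.2) := (shear.tsum_eq _).symm
    _ = ∑' q, ∑' n, inner ℂ (A (n - q)) (B n) := (shear.summable_iff.2 hsum).tsum_prod

variable {d : ℕ} [NeZero d]

theorem exp_mul_gkpPoint (j : ZMod d) (n a : ℤ) :
    Complex.exp (Complex.I * (ell d * a : ℝ) * gkpPoint d j n) = omega d (a * j) := by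
  have hres : (a : ZMod d) * j = ((a * (d * n + j.val) : ℤ) : ZMod d) := by simp
  have hell : (ell d : ℂ) * ell d = 2 * Real.pi / d := by exact_mod_cast ell_mul_self d
  rw [hres, omega_intCast, gkpPoint]
  congr 1
  push_cast
  linear_combination Complex.I * a * (d * n + (j.val : ℂ)) * hell

theorem inner_codewordPeak (g h : 𝓢(ℝ, ℂ)) (ε : ℝ) {δ : ℝ} (hδ : 0 < δ) (j k : ZMod d)
    (a : ℤ × ℤ) (q n : ℤ) :
    inner ℂ (codewordPeak g h ε δ k (n - q))
        (displacement d (a.1, a.2) (codewordPeak g h ε δ j n)) =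
      Complex.exp (Complex.I * Real.pi * a.1 * a.2 / d) * omega d (a.2 * j) * (δ : ℂ)⁻¹ *
        overlap h (ell d * a.2) δ (ell d * (a.1 + d * q + j.val - k.val)) *
        (conj (g (ε * gkpPoint d k (n - q))) * g (ε * gkpPoint d j n)) := by
  have hpos : ell d * (a.1 : ℝ) + gkpPoint d j n - gkpPoint d k (n - q) =
      ell d * (a.1 + d * q + j.val - k.val) := by
    simp only [gkpPoint]; push_cast; ring
  rw [codewordPeak, codewordPeak, map_smul, displacement_apply, modulation_translation, map_smul,
    translation_translation, inner_smul_left, inner_smul_right, inner_smul_right,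
    inner_smul_right, inner_translation_translation, inner_wavePacket h hδ, exp_mul_gkpPoint,
    hpos]
  simp only [Complex.ofReal_intCast]
  ring

/-- The correlation of the envelopes of two codewords, one of them shifted by `q` periods. The
factor `ε` makes it a Riemann sum. -/
noncomputable def envelopeCorrelation (g : 𝓢(ℝ, ℂ)) (j k : ZMod d) (q : ℤ) (ε : ℝ) : ℂ :=
  ε • ∑' n : ℤ, conj (g (ε * gkpPoint d k (n - q))) * g (ε * gkpPoint d j n)

theorem inner_codeword (g h : 𝓢(ℝ, ℂ)) {ε δ : ℝ} (hε : 0 < ε) (hδ : 0 < δ) (j k : ZMod d)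
    (a : ℤ × ℤ) :
    ((ε * δ : ℝ) : ℂ) * inner ℂ (codeword g h ε δ k)
        (displacement d (a.1, a.2) (codeword g h ε δ j)) =
      (Complex.exp (Complex.I * Real.pi * a.1 * a.2 / d) * omega d (a.2 * j) * (ell d : ℂ)⁻¹) *
        ∑' q : ℤ, overlap h (ell d * a.2) δ (ell d * (a.1 + d * q + j.val - k.val)) *
          envelopeCorrelation g j k q ε := by
  have hδ' : (δ : ℂ) ≠ 0 := by exact_mod_cast hδ.ne'
  have hsum := summable_norm_codewordPeak g h hε δ j
  have hnorm : conj (1 / Real.sqrt (ell d) : ℂ) * (1 / Real.sqrt (ell d) : ℂ) =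
      (ell d : ℂ)⁻¹ := by
    rw [map_div₀, map_one, Complex.conj_ofReal, div_mul_div_comm, ← Complex.ofReal_mul,
      Real.mul_self_sqrt (ell_pos d).le, one_mul, one_div]
  rw [codeword, codeword, map_smul, ContinuousLinearMap.map_tsum _ hsum.of_norm, inner_smul_left,
    inner_smul_right, ← mul_assoc (conj _), hnorm, inner_tsum_tsum
      (summable_norm_codewordPeak g h hε δ k) (by simpa only [norm_displacement_apply] using hsum)]
  simp_rw [inner_codewordPeak g h ε hδ, envelopeCorrelation, Complex.real_smul, tsum_mul_left,
    mul_left_comm (overlap _ _ _ _) (ε : ℂ), mul_assoc, tsum_mul_left]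
  push_cast
  field_simp

end MatrixElement

/-! ### Limits of the matrix elements -/

section MatrixElementLimit

variable {d : ℕ}

theorem gkpPoint_eq_period_mul_add (j : ZMod d) (n : ℤ) :
    gkpPoint d j n = d * ell d * n + j.val * ell d := by
  rw [gkpPoint]; ring

theorem gkpPoint_sub_eq_period_mul_add (j : ZMod d) (n q : ℤ) :
    gkpPoint d j (n - q) = d * ell d * n + (j.val - d * q) * ell d := by
  rw [gkpPoint]; push_cast; ring

variable [NeZero d]

theorem period_pos (d : ℕ) [NeZero d] : 0 < d * ell d :=
  mul_pos (by exact_mod_cast Nat.pos_of_neZero d) (ell_pos d)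

theorem tendsto_envelopeCorrelation (g : 𝓢(ℝ, ℂ)) (j k : ZMod d) (q : ℤ) :
    Tendsto (envelopeCorrelation g j k q) (𝓝[>] 0)
      (𝓝 ((d * ell d)⁻¹ • ∫ x, conj (g x) * g x)) := by
  obtain ⟨C, hC⟩ := exists_norm_apply_le_mul_inv_one_add_sq g
  have hΦ : ∀ x y, ‖conj (g x) * g y‖ ≤ SchwartzMap.seminorm ℂ 0 0 g * C * (1 + y ^ 2)⁻¹ := by
    intro x y
    rw [norm_mul, RCLike.norm_conj, mul_assoc]
    exact mul_le_mul (norm_le_seminorm ℂ g x) (hC y) (norm_nonneg _) (apply_nonneg _ _)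
  have hlim := tendsto_riemannSum (Φ := fun x y => conj (g x) * g y) (by fun_prop) hΦ
    (period_pos d) ((k.val - d * q) * ell d) (j.val * ell d)
  simp_rw [← gkpPoint_eq_period_mul_add, ← gkpPoint_sub_eq_period_mul_add] at hlim
  exact hlim

theorem exists_norm_envelopeCorrelation_le (g : 𝓢(ℝ, ℂ)) (j k : ZMod d) :
    ∃ M, ∀ᶠ ε in 𝓝[>] 0, ∀ q, ‖envelopeCorrelation g j k q ε‖ ≤ M := by
  obtain ⟨C, hC⟩ := exists_norm_apply_le_mul_inv_one_add_sq g
  set M := SchwartzMap.seminorm ℂ 0 0 g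
  have hlim := tendsto_riemannSum (Φ := fun _ y => ‖g y‖) (by fun_prop)
    (fun _ y => (norm_norm _).trans_le (hC y)) (period_pos d) 0 (j.val * ell d)
  simp_rw [← gkpPoint_eq_period_mul_add] at hlim
  refine ⟨M * ((d * ell d)⁻¹ • (∫ x, ‖g x‖) + 1), ?_⟩
  filter_upwards [hlim.eventually_le_const (lt_add_one _), self_mem_nhdsWithin] with ε hle hε q
  have hε : 0 < ε := hε
  calc ‖envelopeCorrelation g j k q ε‖
      ≤ ε * (M * ∑' n : ℤ, ‖g (ε * gkpPoint d j n)‖) := by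
        rw [envelopeCorrelation, norm_smul, Real.norm_of_nonneg hε.le]
        gcongr
        refine tsum_of_norm_bounded ((summable_norm_envelope g hε j).hasSum.mul_left M) fun n => ?_
        rw [norm_mul, RCLike.norm_conj]
        gcongr
        exact norm_le_seminorm ℂ g _
    _ = M * (ε • ∑' n : ℤ, ‖g (ε * gkpPoint d j n)‖) := by rw [smul_eq_mul]; ring
    _ ≤ _ := by gcongr

theorem ell_mul_eq_zero_iff (j k : ZMod d) (a q : ℤ) :
    ell d * (a + d * q + j.val - k.val) = 0 ↔ (k.val : ℤ) - j.val - a = d * q := by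
  rw [mul_eq_zero, or_iff_right (ell_pos d).ne', sub_eq_zero]
  constructor
  · intro h
    have h' : (a : ℤ) + d * q + j.val = k.val := by exact_mod_cast h
    lia
  · intro h
    have h' : (a : ℤ) + d * q + j.val = k.val := by lia
    exact_mod_cast h'

theorem tsum_ite_ell_mul_eq_zero (j k : ZMod d) (a : ℤ) (z : ℂ) :
    ∑' q : ℤ, (if ell d * (a + d * q + j.val - k.val) = 0 then z else 0) =
      if k = j + a then z else 0 := by
  have hd : (d : ℤ) ≠ 0 := by exact_mod_cast NeZero.ne d
  have hk : k = j + a ↔ (d : ℤ) ∣ (k.val : ℤ) - j.val - a := by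
    rw [← ZMod.intCast_zmod_eq_zero_iff_dvd]
    simp [sub_sub, sub_eq_zero]
  simp_rw [ell_mul_eq_zero_iff]
  split_ifs with h
  · obtain ⟨q, hq⟩ := hk.1 h
    rw [tsum_eq_single q fun q' hq' => if_neg fun h' =>
      hq' (mul_left_cancel₀ hd (h'.symm.trans hq)), if_pos hq]
  · rw [tsum_congr fun q => if_neg fun h' => h (hk.2 ⟨q, h'⟩), tsum_zero]

theorem inv_one_add_div_sq_le {δ : ℝ} (hδ₀ : 0 < δ) (hδ₁ : δ ≤ 1) (r : ℝ) :
    (1 + (r / δ) ^ 2)⁻¹ ≤ (1 + r ^ 2)⁻¹ := by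
  rw [div_pow]
  gcongr
  exact le_div_self (sq_nonneg r) (by positivity) (pow_le_one₀ hδ₀.le hδ₁)

theorem tendsto_tsum_overlap_mul_envelopeCorrelation (g h : 𝓢(ℝ, ℂ)) (j k : ZMod d)
    (a : ℤ × ℤ) :
    Tendsto (fun p : ℝ × ℝ => ∑' q : ℤ,
        overlap h (ell d * a.2) p.2 (ell d * (a.1 + d * q + j.val - k.val)) *
          envelopeCorrelation g j k q p.1) (𝓝[>] 0 ×ˢ 𝓝[>] 0)
      (𝓝 (if k = j + a.1 then
        (∫ s, conj (h s) * h s) * ((d * ell d)⁻¹ • ∫ x, conj (g x) * g x) else 0)) := by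
  obtain ⟨C, hC, hoverlap⟩ := exists_norm_overlap_le h
  obtain ⟨M, hM⟩ := exists_norm_envelopeCorrelation_le g j k
  have hslope : ell d * d ≠ 0 := by rw [mul_comm]; exact (period_pos d).ne'
  have hδ : ∀ᶠ δ : ℝ in 𝓝[>] 0, 0 < δ ∧ δ ≤ 1 := Ioc_mem_nhdsGT one_pos
  rw [← tsum_ite_ell_mul_eq_zero]
  refine tendsto_tsum_of_dominated_convergence (bound := fun q : ℤ =>
      C * (1 + (ell d * d * q + ell d * (a.1 + j.val - k.val)) ^ 2)⁻¹ * M)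
    (((summable_inv_one_add_affine_sq hslope _).mul_left C).mul_right M) (fun q => ?_) ?_
  · have hlim := ((tendsto_overlap h (ell d * a.2) (ell d * (a.1 + d * q + j.val - k.val))).comp
      tendsto_snd).mul ((tendsto_envelopeCorrelation g j k q).comp tendsto_fst)
    rwa [ite_mul, zero_mul] at hlim
  · filter_upwards [hM.prod_mk hδ] with p ⟨hp, hδ₀, hδ₁⟩ q
    have haffine : ell d * d * q + ell d * (a.1 + j.val - k.val) =
        ell d * (a.1 + d * q + j.val - k.val) := by ring
    rw [norm_mul, haffine]
    refine mul_le_mul ((hoverlap _ _ _).trans ?_) (hp q) (norm_nonneg _) (by positivity)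
    exact mul_le_mul_of_nonneg_left (inv_one_add_div_sq_le hδ₀ hδ₁ _) hC

/-- The sign `(-1) ^ (a_X a_Z)`, by which the displacement `T_a` of the mode, `a ∈ ℤ²`, differs from
the Weyl operator of `a mod d` on the code space. -/
noncomputable def paritySign (a : ℤ × ℤ) : ℂ := Complex.exp (Complex.I * Real.pi * a.1 * a.2)

theorem paritySign_mul_self (a : ℤ × ℤ) : paritySign a * paritySign a = 1 := by
  rw [paritySign, ← Complex.exp_add]
  exact Complex.exp_eq_one_iff.2 ⟨a.1 * a.2, by push_cast; ring⟩

theorem paritySign_zero : paritySign 0 = 1 := by simp [paritySign]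

theorem exp_div_eq_paritySign_mul_omega (hd : Odd d) (a : ℤ × ℤ) :
    Complex.exp (Complex.I * Real.pi * a.1 * a.2 / d) =
      paritySign a * omega d (half d * a.1 * a.2) := by
  obtain ⟨m, rfl⟩ := hd
  have hd' : (2 * m + 1 : ℂ) ≠ 0 := by exact_mod_cast NeZero.ne (2 * m + 1)
  have hhalf : half (2 * m + 1) * (a.1 : ZMod (2 * m + 1)) * a.2 =
      (((m + 1) * a.1 * a.2 : ℤ) : ZMod (2 * m + 1)) := by
    rw [half, show (2 * m + 1 + 1) / 2 = m + 1 by lia]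
    push_cast
    ring
  rw [hhalf, omega_intCast, paritySign, ← Complex.exp_add,
    Complex.exp_eq_exp_iff_exists_int]
  refine ⟨-(a.1 * a.2), ?_⟩
  push_cast
  field_simp
  ring

/-- The limit of `ε δ ‖E |j_GKP⟩‖²`, the same for every codeword. -/
noncomputable def codewordNormSqLimit (d : ℕ) (g h : 𝓢(ℝ, ℂ)) : ℂ :=
  (ell d : ℂ)⁻¹ * ((∫ s, conj (h s) * h s) * ((d * ell d)⁻¹ • ∫ x, conj (g x) * g x))

theorem integral_conj_mul_self_ne_zero {g : 𝓢(ℝ, ℂ)} (hg : g ≠ 0) :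
    ∫ x, conj (g x) * g x ≠ 0 := by
  have hinner := g.inner_toL2_toL2_eq g volume
  simp only [RCLike.inner_apply'] at hinner
  rw [← hinner, inner_self_ne_zero]
  exact fun h0 => hg (injective_toLp (F := ℂ) 2 volume
    (h0.trans ((toLpCLM ℂ ℂ 2 volume).map_zero).symm))

theorem codewordNormSqLimit_ne_zero {g h : 𝓢(ℝ, ℂ)} (hg : g ≠ 0) (hh : h ≠ 0) :
    codewordNormSqLimit d g h ≠ 0 :=
  mul_ne_zero (inv_ne_zero (by exact_mod_cast (ell_pos d).ne'))
    (mul_ne_zero (integral_conj_mul_self_ne_zero hh)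
      (smul_ne_zero (inv_ne_zero (period_pos d).ne') (integral_conj_mul_self_ne_zero hg)))

theorem eventually_pos_prod : ∀ᶠ p : ℝ × ℝ in 𝓝[>] 0 ×ˢ 𝓝[>] 0, 0 < p.1 ∧ 0 < p.2 :=
  prod_mem_prod self_mem_nhdsWithin self_mem_nhdsWithin

theorem tendsto_inner_codeword (hd : Odd d) (g h : 𝓢(ℝ, ℂ)) (j k : ZMod d) (a : ℤ × ℤ) :
    Tendsto (fun p : ℝ × ℝ => ((p.1 * p.2 : ℝ) : ℂ) * inner ℂ (codeword g h p.1 p.2 k)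
        (displacement d (a.1, a.2) (codeword g h p.1 p.2 j))) (𝓝[>] 0 ×ˢ 𝓝[>] 0)
      (𝓝 (codewordNormSqLimit d g h * (paritySign a * weyl d (a.1, a.2) k j))) := by
  have hlim := (tendsto_tsum_overlap_mul_envelopeCorrelation g h j k a).const_mul
    (Complex.exp (Complex.I * Real.pi * a.1 * a.2 / d) * omega d (a.2 * j) * (ell d : ℂ)⁻¹)
  have hvalue : (Complex.exp (Complex.I * Real.pi * a.1 * a.2 / d) * omega d (a.2 * j) *
      (ell d : ℂ)⁻¹) * (if k = j + a.1 then
        (∫ s, conj (h s) * h s) * ((d * ell d)⁻¹ • ∫ x, conj (g x) * g x) else 0) =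
      codewordNormSqLimit d g h * (paritySign a * weyl d (a.1, a.2) k j) := by
    rw [weyl_apply, omega_add, exp_div_eq_paritySign_mul_omega hd, codewordNormSqLimit]
    split_ifs <;> ring
  rw [hvalue] at hlim
  refine hlim.congr' ?_
  filter_upwards [eventually_pos_prod] with p ⟨hε, hδ⟩
  exact (inner_codeword g h hε hδ j k a).symm

end MatrixElementLimit

/-! ### The Fourier expansion of the Wigner comb -/

section GrossPoisson

open scoped FourierTransform RealInnerProductSpace

variable {d : ℕ} [NeZero d]

theorem bijective_val_add_mul :
    Function.Bijective fun p : ZMod d × ℤ => (p.1.val + d * p.2 : ℤ) := by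
  refine ⟨fun p p' hp => ?_, fun x => ?_⟩
  · have hfst : p.1 = p'.1 := by simpa using congrArg (Int.cast : ℤ → ZMod d) hp
    refine Prod.ext hfst ?_
    simpa [hfst, NeZero.ne d] using hp
  · have hx : ((x - (x : ZMod d).val : ℤ) : ZMod d) = 0 := by simp
    obtain ⟨b, hb⟩ := (ZMod.intCast_zmod_eq_zero_iff_dvd _ _).1 hx
    exact ⟨(x, b), by simp only [← hb, add_sub_cancel]⟩

theorem tsum_eq_sum_tsum_residue {F : ℤ × ℤ → ℂ} (hF : Summable F) :
    ∑' a, F a = ∑ t : ZMod d × ZMod d, ∑' b : ℤ × ℤ,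
      F (t.1.val + d * b.1, t.2.val + d * b.2) := by
  let e₁ : ZMod d × ℤ ≃ ℤ := .ofBijective _ bijective_val_add_mul
  let e : (ZMod d × ZMod d) × ℤ × ℤ ≃ ℤ × ℤ :=
    (Equiv.prodProdProdComm _ _ _ _).trans (e₁.prodCongr e₁)
  rw [← e.tsum_eq F, ← tsum_fintype (L := .unconditional _)]
  exact (e.summable_iff.2 hF).tsum_prod

/-- The point of `ℝ²` at which the Fourier transform is sampled by the displacement `T_a`. -/
noncomputable def dualPoint (d : ℕ) (a : ℤ × ℤ) : Phase :=
  (d * ell d)⁻¹ • !₂[(a.2 : ℝ), -(a.1 : ℝ)]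

/-- The quarter turn of the lattice `ℤ²`. -/
def quarterTurn : ℤ × ℤ ≃ ℤ × ℤ :=
  ⟨fun a => (a.2, -a.1), fun a => (-a.2, a.1), fun a => by simp, fun a => by simp⟩

theorem dualPoint_eq_smul_quarterTurn (d : ℕ) (a : ℤ × ℤ) :
    dualPoint d a = (d * ell d)⁻¹ • !₂[((quarterTurn a).1 : ℝ), ((quarterTurn a).2 : ℝ)] := by
  simp [dualPoint, quarterTurn]

theorem summable_norm_dualPoint (f : 𝓢(Phase, ℂ)) :
    Summable fun a : ℤ × ℤ => ‖f (dualPoint d a)‖ := by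
  have hL : (d * ell d)⁻¹ ≠ 0 := inv_ne_zero (period_pos d).ne'
  refine (quarterTurn.summable_iff.2 (summable_norm_lattice f hL hL)).congr fun a => ?_
  rw [dualPoint_eq_smul_quarterTurn, Function.comp_apply]
  congr 2
  ext i
  fin_cases i <;> simp

theorem latticePoint_residue (t : ZMod d × ZMod d) (b : ℤ × ℤ) :
    latticePoint d (t.1.val + d * b.1, t.2.val + d * b.2) =
      (d * ell d) • !₂[(b.1 : ℝ), (b.2 : ℝ)] + latticePoint d (t.1.val, t.2.val) := by
  ext i
  fin_cases i <;> simp [latticePoint] <;> ring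

theorem fourierChar_inner_latticePoint_dualPoint (t : ZMod d × ZMod d) (a : ℤ × ℤ) :
    (𝐞 ⟪latticePoint d (t.1.val, t.2.val), dualPoint d a⟫ : ℂ) = omega d (symp t (a.1, a.2)) := by
  have hsymp : symp t ((a.1 : ZMod d), (a.2 : ZMod d)) =
      ((t.1.val * a.2 - t.2.val * a.1 : ℤ) : ZMod d) := by simp [symp]
  have hinner : ⟪latticePoint d (t.1.val, t.2.val), dualPoint d a⟫ =
      (t.1.val * a.2 - t.2.val * a.1) / d := by
    have hell := (ell_pos d).ne'
    simp only [latticePoint, dualPoint, inner_smul_right, PiLp.inner_apply, Fin.sum_univ_two,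
      RCLike.inner_apply, conj_trivial, Matrix.cons_val_zero, Matrix.cons_val_one, Int.cast_natCast]
    field_simp
    ring
  rw [hsymp, omega_intCast, Real.fourierChar_apply, hinner]
  congr 1
  push_cast
  ring

theorem tsum_latticePoint_residue (f : 𝓢(Phase, ℂ)) (t : ZMod d × ZMod d) :
    ∑' b : ℤ × ℤ, f (latticePoint d (t.1.val + d * b.1, t.2.val + d * b.2)) =
      (1 / (2 * Real.pi) : ℂ) * ((1 / d : ℂ) * ∑' a : ℤ × ℤ,
        omega d (symp t (a.1, a.2)) * 𝓕 f (dualPoint d a)) := by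
  have harea : (((d * ell d) ^ 2 : ℝ) : ℂ)⁻¹ = (1 / (2 * Real.pi) : ℂ) * (1 / d : ℂ) := by
    have hd : (d : ℝ) ≠ 0 := NeZero.ne _
    have hsq : (d * ell d) ^ 2 = 2 * Real.pi * d := by
      rw [mul_pow, sq (ell d), ell_mul_self]; field_simp
    rw [hsq]
    push_cast
    rw [mul_inv, one_div, one_div]
  simp_rw [latticePoint_residue]
  rw [tsum_affine_lattice f (period_pos d).ne', ← quarterTurn.tsum_eq, ← mul_assoc, ← harea,
    Complex.ofReal_inv]
  simp_rw [← dualPoint_eq_smul_quarterTurn, Circle.smul_def,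
    fourierChar_inner_latticePoint_dualPoint, smul_eq_mul]

theorem latticeComb_eq_sum (w : ZMod d × ZMod d → ℂ) (f : 𝓢(Phase, ℂ)) :
    latticeComb w f = ∑ t, w t * ∑' b : ℤ × ℤ,
      f (latticePoint d (t.1.val + d * b.1, t.2.val + d * b.2)) := by
  rw [latticeComb_apply, tsum_eq_sum_tsum_residue (d := d)
    (summable_mul_apply (summable_norm_mul_latticeWeight w) f)]
  simp [tsum_mul_left]

/- The comb is `d ℓ`-periodic, so by Poisson summation it is a combination of the plane waves that
define the phase point operators, and finite Fourier inversion identifies their coefficients. -/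
theorem latticeComb_grossWigner (ρ : Matrix (ZMod d) (ZMod d) ℂ) (f : 𝓢(Phase, ℂ)) :
    latticeComb (grossWigner d ρ) f = (1 / (2 * Real.pi) : ℂ) * ∑' a : ℤ × ℤ,
      𝓕 f (dualPoint d a) * (weyl d (a.1, a.2) * ρ).trace := by
  have hsum (t : ZMod d × ZMod d) : Summable fun a : ℤ × ℤ =>
      grossWigner d ρ t * (1 / d : ℂ) * (omega d (symp t (a.1, a.2)) * 𝓕 f (dualPoint d a)) := by
    refine Summable.mul_left _ (Summable.of_norm ?_)
    simpa [omega, AddChar.norm_apply] using summable_norm_dualPoint (𝓕 f)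
  calc latticeComb (grossWigner d ρ) f
      = (1 / (2 * Real.pi) : ℂ) * ∑ t, ∑' a : ℤ × ℤ, grossWigner d ρ t * (1 / d : ℂ) *
          (omega d (symp t (a.1, a.2)) * 𝓕 f (dualPoint d a)) := by
        simp_rw [latticeComb_eq_sum, tsum_latticePoint_residue,
          mul_left_comm (grossWigner d ρ _), ← Finset.mul_sum, tsum_mul_left]
        simp_rw [mul_assoc, mul_left_comm (grossWigner d ρ _), ← Finset.mul_sum]
    _ = (1 / (2 * Real.pi) : ℂ) * ∑' a : ℤ × ℤ, ∑ t, grossWigner d ρ t * (1 / d : ℂ) *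
          (omega d (symp t (a.1, a.2)) * 𝓕 f (dualPoint d a)) := by
        rw [Summable.tsum_finsetSum fun t _ => hsum t]
    _ = _ := by
        simp_rw [trace_weyl_mul_eq_sum_grossWigner, Finset.mul_sum]
        congr! 4
        ring

end GrossPoisson

/-! ### The Zak-Gross Wigner function of an ideal GKP state -/

section Limit

open scoped FourierTransform

variable {d : ℕ} [NeZero d]

/-- The coefficient of the displacement `T_a` in the phase point operator smeared with `f`. -/
noncomputable def phaseCoeff (d : ℕ) (f : 𝓢(Phase, ℂ)) (a : ℤ × ℤ) : ℂ :=
  ∫ η : Phase, f η * Complex.exp (Complex.I * ell d * symp ((a.1 : ℝ), (a.2 : ℝ)) (η 0, η 1)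
    + Complex.I * Real.pi * a.1 * a.2)

theorem phaseCoeff_eq (f : 𝓢(Phase, ℂ)) (a : ℤ × ℤ) :
    phaseCoeff d f a = paritySign a * 𝓕 f (dualPoint d a) := by
  have hell : 2 * Real.pi * (d * ell d)⁻¹ = ell d := by
    have hd : (d : ℝ) ≠ 0 := NeZero.ne _
    rw [← div_eq_mul_inv, div_eq_iff (period_pos d).ne', mul_left_comm, ell_mul_self]
    field_simp
  rw [SchwartzMap.fourier_coe, Real.fourier_eq', paritySign, ← integral_const_mul, phaseCoeff]
  refine integral_congr_ae (.of_forall fun η => ?_)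
  have hinner : -2 * Real.pi * inner ℝ η (dualPoint d a) =
      ell d * symp ((a.1 : ℝ), (a.2 : ℝ)) (η 0, η 1) := by
    simp only [dualPoint, inner_smul_right, PiLp.inner_apply, Fin.sum_univ_two,
      RCLike.inner_apply, conj_trivial, Matrix.cons_val_zero, Matrix.cons_val_one, symp]
    linear_combination (a.1 * η 1 - a.2 * η 0) * hell
  simp only [hinner, smul_eq_mul]
  rw [← mul_assoc, ← Complex.exp_add, mul_comm (f η)]
  congr 2
  push_cast
  ring

theorem norm_paritySign (a : ℤ × ℤ) : ‖paritySign a‖ = 1 := by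
  simpa [paritySign, mul_assoc] using norm_exp_I_mul_mul Real.pi (a.1 * a.2)

theorem summable_norm_phaseCoeff (f : 𝓢(Phase, ℂ)) :
    Summable fun a : ℤ × ℤ => ‖phaseCoeff d f a‖ := by
  simp_rw [phaseCoeff_eq, norm_mul, norm_paritySign, one_mul]
  exact summable_norm_dualPoint (𝓕 f)

theorem hasSum_trace_mixture_comp (ρ : Matrix (ZMod d) (ZMod d) ℂ) (u : ZMod d → Mode)
    {ι : Type*} {B : ι → Mode →L[ℂ] Mode} {S : Mode →L[ℂ] Mode} (hB : HasSum B S) :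
    HasSum (fun i => trace (mixture ρ u ∘L B i)) (trace (mixture ρ u ∘L S)) := by
  simp_rw [trace_mixture_comp]
  exact hasSum_sum fun j _ => hasSum_sum fun k _ =>
    ((hB.mapL (ContinuousLinearMap.apply ℂ Mode (u j))).mapL (innerSL ℂ (u k))).mul_left (ρ j k)

theorem trace_mixture_comp_phasePoint (ρ : Matrix (ZMod d) (ZMod d) ℂ) (u : ZMod d → Mode)
    (f : 𝓢(Phase, ℂ)) :
    trace (mixture ρ u ∘L phasePoint d f) = (1 / (2 * Real.pi) : ℂ) *
      ∑' a : ℤ × ℤ, phaseCoeff d f a * trace (mixture ρ u ∘L displacement d (a.1, a.2)) := by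
  have hsum : Summable fun a : ℤ × ℤ => phaseCoeff d f a • displacement d (a.1, a.2) := by
    refine .of_norm_bounded (summable_norm_phaseCoeff (d := d) f) fun a => ?_
    rw [norm_smul]
    exact mul_le_of_le_one_right (norm_nonneg _) (norm_displacement_le d _)
  have htrace := (hasSum_trace_mixture_comp ρ u hsum.hasSum).tsum_eq
  simp_rw [ContinuousLinearMap.comp_smul, ← ContinuousLinearMap.smul_comp, trace_smul_comp]
    at htrace
  rw [htrace, ← trace_smul_comp, ContinuousLinearMap.smul_comp, ← ContinuousLinearMap.comp_smul]
  rfl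

theorem tendsto_trace_mixture_comp_displacement (hd : Odd d) (ρ : Matrix (ZMod d) (ZMod d) ℂ)
    (g h : 𝓢(ℝ, ℂ)) (a : ℤ × ℤ) :
    Tendsto (fun p : ℝ × ℝ => ((p.1 * p.2 : ℝ) : ℂ) *
        trace (mixture ρ (codeword g h p.1 p.2) ∘L displacement d (a.1, a.2)))
      (𝓝[>] 0 ×ˢ 𝓝[>] 0)
      (𝓝 (codewordNormSqLimit d g h * (paritySign a * (weyl d (a.1, a.2) * ρ).trace))) := by
  have htrace : (weyl d (a.1, a.2) * ρ).trace = ∑ j, ∑ k, ρ j k * weyl d (a.1, a.2) k j := by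
    rw [Matrix.trace_mul_comm]
    simp only [Matrix.trace, Matrix.diag_apply, Matrix.mul_apply]
  simp_rw [htrace, trace_mixture_comp, Finset.mul_sum, mul_left_comm _ (ρ _ _)]
  exact tendsto_finsetSum _ fun j _ => tendsto_finsetSum _ fun k _ =>
    (tendsto_inner_codeword hd g h j k a).const_mul (ρ j k)

theorem tendsto_trace_mixture_codeword (hd : Odd d) {ρ : Matrix (ZMod d) (ZMod d) ℂ}
    (hρ : ρ.trace = 1) (g h : 𝓢(ℝ, ℂ)) :
    Tendsto (fun p : ℝ × ℝ => ((p.1 * p.2 : ℝ) : ℂ) * trace (mixture ρ (codeword g h p.1 p.2)))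
      (𝓝[>] 0 ×ˢ 𝓝[>] 0) (𝓝 (codewordNormSqLimit d g h)) := by
  have hlim := tendsto_trace_mixture_comp_displacement hd ρ g h (0, 0)
  have hweyl : weyl d (0, 0) = 1 := weyl_zero
  have hdisp : displacement d (0, 0) = ContinuousLinearMap.id ℂ Mode := displacement_zero d
  have hsign : paritySign (0, 0) = 1 := paritySign_zero
  simpa only [Int.cast_zero, hweyl, hdisp, hsign, ContinuousLinearMap.comp_id, one_mul, hρ,
    mul_one] using hlim

theorem exists_mul_sum_norm_codeword_sq_le (hd : Odd d) (g h : 𝓢(ℝ, ℂ)) :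
    ∃ M : ℝ, ∀ᶠ p : ℝ × ℝ in 𝓝[>] 0 ×ˢ 𝓝[>] 0,
      p.1 * p.2 * ∑ i : ZMod d, ‖codeword g h p.1 p.2 i‖ ^ 2 ≤ M := by
  have hlim := tendsto_finsetSum Finset.univ fun i (_ : i ∈ Finset.univ) =>
    (Complex.continuous_re.tendsto _).comp (tendsto_inner_codeword hd g h i i (0, 0))
  refine ⟨_, (hlim.eventually_le_const (lt_add_one _)).mono fun p hp => le_of_eq_of_le ?_ hp⟩
  have hdisp : displacement d (0, 0) = ContinuousLinearMap.id ℂ Mode := displacement_zero d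
  simp only [Int.cast_zero, hdisp, Function.comp_apply, ContinuousLinearMap.id_apply,
    Complex.re_ofReal_mul, Finset.mul_sum]
  simp_rw [← RCLike.re_eq_complex_re, ← norm_sq_eq_re_inner]

theorem norm_mul_trace_mixture_comp_displacement_le (ρ : Matrix (ZMod d) (ZMod d) ℂ)
    (u : ZMod d → Mode) (a : ℝ × ℝ) {r M : ℝ} (hr : 0 ≤ r) (hM : r * ∑ i, ‖u i‖ ^ 2 ≤ M) :
    ‖(r : ℂ) * trace (mixture ρ u ∘L displacement d a)‖ ≤ (∑ j, ∑ k, ‖ρ j k‖) * M := by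
  rw [norm_mul, Complex.norm_real, Real.norm_of_nonneg hr]
  calc r * ‖trace (mixture ρ u ∘L displacement d a)‖
      ≤ r * ((∑ j, ∑ k, ‖ρ j k‖) * (∑ i, ‖u i‖ ^ 2) * 1) := by
        gcongr
        exact (norm_trace_mixture_comp_le ρ _ _).trans (by gcongr; exact norm_displacement_le d _)
    _ = (∑ j, ∑ k, ‖ρ j k‖) * (r * ∑ i, ‖u i‖ ^ 2) := by ring
    _ ≤ (∑ j, ∑ k, ‖ρ j k‖) * M := by gcongr

theorem tsum_phaseCoeff_mul_eq_latticeComb_grossWigner (ρ : Matrix (ZMod d) (ZMod d) ℂ)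
    (f : 𝓢(Phase, ℂ)) :
    (1 / (2 * Real.pi) : ℂ) *
        ∑' a : ℤ × ℤ, phaseCoeff d f a * (paritySign a * (weyl d (a.1, a.2) * ρ).trace) =
      latticeComb (grossWigner d ρ) f := by
  rw [latticeComb_grossWigner]
  congr! 3 with a
  rw [phaseCoeff_eq]
  linear_combination (𝓕 f (dualPoint d a) * (weyl d (a.1, a.2) * ρ).trace) * paritySign_mul_self a

theorem tendsto_trace_mixture_comp_phasePoint (hd : Odd d) (ρ : Matrix (ZMod d) (ZMod d) ℂ)
    (g h : 𝓢(ℝ, ℂ)) (f : 𝓢(Phase, ℂ)) :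
    Tendsto (fun p : ℝ × ℝ => ((p.1 * p.2 : ℝ) : ℂ) *
        trace (mixture ρ (codeword g h p.1 p.2) ∘L phasePoint d f)) (𝓝[>] 0 ×ˢ 𝓝[>] 0)
      (𝓝 (codewordNormSqLimit d g h * latticeComb (grossWigner d ρ) f)) := by
  obtain ⟨M, hM⟩ := exists_mul_sum_norm_codeword_sq_le hd g h
  have hlim : Tendsto (fun p : ℝ × ℝ => ∑' a : ℤ × ℤ, phaseCoeff d f a *
      (((p.1 * p.2 : ℝ) : ℂ) *
        trace (mixture ρ (codeword g h p.1 p.2) ∘L displacement d (a.1, a.2))))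
      (𝓝[>] 0 ×ˢ 𝓝[>] 0)
      (𝓝 (∑' a : ℤ × ℤ, phaseCoeff d f a *
        (codewordNormSqLimit d g h * (paritySign a * (weyl d (a.1, a.2) * ρ).trace)))) := by
    refine tendsto_tsum_of_dominated_convergence
      ((summable_norm_phaseCoeff (d := d) f).mul_right ((∑ j, ∑ k, ‖ρ j k‖) * M))
      (fun a => (tendsto_trace_mixture_comp_displacement hd ρ g h a).const_mul _) ?_
    filter_upwards [hM, eventually_pos_prod] with p hp ⟨hε, hδ⟩ a
    rw [norm_mul]
    exact mul_le_mul_of_nonneg_left (norm_mul_trace_mixture_comp_displacement_le ρ _ _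
      (mul_pos hε hδ).le hp) (norm_nonneg _)
  simp_rw [mul_left_comm (phaseCoeff d f _) (codewordNormSqLimit d g h),
    mul_left_comm (phaseCoeff d f _) (((_ : ℝ) : ℂ)), tsum_mul_left] at hlim
  rw [← tsum_phaseCoeff_mul_eq_latticeComb_grossWigner, mul_left_comm]
  refine (hlim.const_mul (1 / (2 * Real.pi) : ℂ)).congr fun p => ?_
  rw [trace_mixture_comp_phasePoint, mul_left_comm]

theorem ne_zero_of_apply_zero_eq_one {g : 𝓢(ℝ, ℂ)} (hg : g 0 = 1) : g ≠ 0 := by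
  rintro rfl
  simp at hg

theorem ne_zero_of_integral_eq_one {h : 𝓢(ℝ, ℂ)} (hh : ∫ x, h x = 1) : h ≠ 0 := by
  rintro rfl
  simp at hh

section Regularized

variable {g h : 𝓢(ℝ, ℂ)} {ρ : Matrix (ZMod d) (ZMod d) ℂ}

theorem eventually_trace_mixture_codeword_ne_zero (hd : Odd d) (hg : g ≠ 0) (hh : h ≠ 0)
    (hρ : ρ.trace = 1) :
    ∀ᶠ p : ℝ × ℝ in 𝓝[>] 0 ×ˢ 𝓝[>] 0, trace (mixture ρ (codeword g h p.1 p.2)) ≠ 0 :=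
  ((tendsto_trace_mixture_codeword hd hρ g h).eventually_ne
    (codewordNormSqLimit_ne_zero hg hh)).mono fun _ => right_ne_zero_of_mul

theorem tendsto_zakGross_mixture_codeword (hd : Odd d) (hg : g ≠ 0) (hh : h ≠ 0)
    (hρ : ρ.trace = 1) (f : 𝓢(Phase, ℂ)) :
    Tendsto (fun p : ℝ × ℝ => zakGross d ((trace (mixture ρ (codeword g h p.1 p.2)))⁻¹ •
        mixture ρ (codeword g h p.1 p.2)) f) (𝓝[>] 0 ×ˢ 𝓝[>] 0)
      (𝓝 (latticeComb (grossWigner d ρ) f)) := by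
  have hΛ := codewordNormSqLimit_ne_zero (d := d) hg hh
  have hlim := (tendsto_trace_mixture_comp_phasePoint hd ρ g h f).div
    (tendsto_trace_mixture_codeword hd hρ g h) hΛ
  rw [mul_div_cancel_left₀ _ hΛ] at hlim
  refine hlim.congr' ?_
  filter_upwards [eventually_pos_prod] with p ⟨hε, hδ⟩
  have hεδ : ((p.1 * p.2 : ℝ) : ℂ) ≠ 0 := by exact_mod_cast (mul_pos hε hδ).ne'
  rw [Pi.div_apply, zakGross, trace_smul_comp, mul_div_mul_left _ _ hεδ, div_eq_inv_mul]

end Regularized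

theorem hasZakGross_latticeComb (hd : Odd d) {ρ : Matrix (ZMod d) (ZMod d) ℂ}
    (hρ : ρ.trace = 1) :
    HasZakGross d (gkpEncode d ρ) (latticeComb (grossWigner d ρ)) := fun g h hg hh =>
  have hg := ne_zero_of_apply_zero_eq_one hg
  have hh := ne_zero_of_integral_eq_one hh
  ⟨fun ε δ => mixture ρ (codeword g h ε δ),
    fun _ _ hε hδ => isIntegralOperator_mixture_codeword ρ g h hε hδ,
    eventually_trace_mixture_codeword_ne_zero hd hg hh hρ,
    tendsto_zakGross_mixture_codeword hd hg hh hρ⟩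

theorem exists_regularization : ∃ g h : 𝓢(ℝ, ℂ), g 0 = 1 ∧ ∫ x, h x = 1 := by
  let φ : ContDiffBump (0 : ℝ) := ⟨1, 2, one_pos, one_lt_two⟩
  have hg : HasCompactSupport fun x => (φ x : ℂ) :=
    φ.hasCompactSupport.comp_left Complex.ofReal_zero
  have hh : HasCompactSupport fun x => (φ.normed volume x : ℂ) :=
    φ.hasCompactSupport_normed.comp_left Complex.ofReal_zero
  refine ⟨hg.toSchwartzMap (Complex.ofRealCLM.contDiff.comp φ.contDiff),
    hh.toSchwartzMap (Complex.ofRealCLM.contDiff.comp φ.contDiff_normed), ?_, ?_⟩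
  · change ((φ 0 : ℝ) : ℂ) = 1
    rw [φ.one_of_mem_closedBall (Metric.mem_closedBall_self zero_le_one), Complex.ofReal_one]
  · change ∫ x, (φ.normed volume x : ℂ) = 1
    rw [integral_complex_ofReal, φ.integral_normed, Complex.ofReal_one]

theorem hasZakGross_gkpEncode_iff (hd : Odd d) {ρ : Matrix (ZMod d) (ZMod d) ℂ}
    (hρ : ρ.trace = 1) (W : 𝓢'(Phase, ℂ)) :
    HasZakGross d (gkpEncode d ρ) W ↔ W = latticeComb (grossWigner d ρ) := by
  refine ⟨fun hW => ?_, fun hW => hW ▸ hasZakGross_latticeComb hd hρ⟩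
  obtain ⟨g, h, hg, hh⟩ := exists_regularization
  obtain ⟨A, hA, -, hlim⟩ := hW g h hg hh
  ext f
  refine tendsto_nhds_unique (hlim f) ((tendsto_zakGross_mixture_codeword hd
    (ne_zero_of_apply_zero_eq_one hg) (ne_zero_of_integral_eq_one hh) hρ f).congr' ?_)
  filter_upwards [eventually_pos_prod] with p ⟨hε, hδ⟩
  rw [(hA p.1 p.2 hε hδ).unique (isIntegralOperator_mixture_codeword ρ g h hε hδ)]

end Limit

end ZakGross

theorem corollary1_general (d : ℕ) [NeZero d] (hd : Odd d)
    (ρ : Matrix (ZMod d) (ZMod d) ℂ) (hρ : ρ.trace = 1) :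
    ∃ W : 𝓢'(ZakGross.Phase, ℂ),
      (∀ W' : 𝓢'(ZakGross.Phase, ℂ),
        ZakGross.HasZakGross d (ZakGross.gkpEncode d ρ) W' ↔ W' = W) ∧
      HasSum (fun a : ℤ × ℤ => ZakGross.grossWigner d ρ ((a.1 : ZMod d), (a.2 : ZMod d)) •
        TemperedDistribution.delta (ZakGross.latticePoint d a)) W ∧
      ((∀ t : ZMod d × ZMod d, 0 ≤ ZakGross.grossWigner d ρ t) → ZakGross.IsNonneg W) ∧
      (ZakGross.IsStabilizerState d ρ → ZakGross.IsNonneg W) :=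
  ⟨ZakGross.latticeComb (ZakGross.grossWigner d ρ), ZakGross.hasZakGross_gkpEncode_iff hd hρ,
    ZakGross.hasSum_latticeComb _, ZakGross.isNonneg_latticeComb,
    fun hs => ZakGross.isNonneg_latticeComb
      (ZakGross.grossWigner_nonneg_of_isStabilizerState hd hs)⟩

theorem corollary1 (d : ℕ) [NeZero d] (hd : Odd d)
    (ρ : Matrix (ZMod d) (ZMod d) ℂ) (hρ : ZakGross.IsState d ρ) :
    ∃ W : 𝓢'(ZakGross.Phase, ℂ),
      (∀ W' : 𝓢'(ZakGross.Phase, ℂ),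
        ZakGross.HasZakGross d (ZakGross.gkpEncode d ρ) W' ↔ W' = W) ∧
      HasSum (fun a : ℤ × ℤ => ZakGross.grossWigner d ρ ((a.1 : ZMod d), (a.2 : ZMod d)) •
        TemperedDistribution.delta (ZakGross.latticePoint d a)) W ∧
      ((∀ t : ZMod d × ZMod d, 0 ≤ ZakGross.grossWigner d ρ t) → ZakGross.IsNonneg W) ∧
      (ZakGross.IsStabilizerState d ρ → ZakGross.IsNonneg W) :=
  corollary1_general d hd ρ hρ.2
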